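/- Let $n\ge 1$. A domain is a nonempty connected open subset of $\mathbb{C}^n$. Let $\Omega\subset\mathbb{C}^n$ be a bounded, convex domain that is balanced (i.e. $\lambda z\in\Omega$ whenever $z\in\Omega$ and $\lambda\in\mathbb{C}$, $|\lambda|\le 1$), let $\rho_\Omega(z)=\inf\{t>0:\ z/t\in\Omega\}$ be its Minkowski function, and for $0<r<1$ put $\Omega(r)=\{z\in\mathbb{C}^n:\ \rho_\Omega(z)<r\}$. For a bounded domain $G\subset\mathbb{C}^n$ and $z\in G$, the generalized squeezing function is $$s_G^\Omega(z)=\sup\{r\in(0,1):\ \Omega(r)\subset f(G)\text{ for some injective holomorphic map } f:G\to\Omega \text{ with } f(z)=0\}.$$ Let $D\subset\mathbb{C}^n$ be a bounded domain, and let $\{D_l\}_{l\ge 1}$ be a sequence of subdomains of $D$ that exhausts $D$, i.e. for every compact $K\subset D$ there is $N$ such that $K\subset D_l$ for all $l>N$. Then $\lim_{l\to\infty}s_{D_l}^\Omega(z)=s_D^\Omega(z)$ for every $z\in D$, and the convergence is uniform on compact subsets of $D$. (For each compact $K\subset D$, the functions $s_{D_l}^\Omega$ are defined on $K$ for all sufficiently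 large $l$.) -/

import Mathlib

open Filter Topology

noncomputable section

namespace GenSqueezing

/-- The complex Euclidean space `ℂⁿ`. -/
abbrev Cn (n : ℕ) : Type := EuclideanSpace ℂ (Fin n)

/-- A domain in `ℂⁿ`: a nonempty, connected, open subset. -/
def IsDomainIn {n : ℕ} (D : Set (Cn n)) : Prop :=
  IsOpen D ∧ IsConnected D

/-- `f` restricts to an injective holomorphic map from `D₁` into `D₂`. -/
def IsInjHol {n : ℕ} (D₁ D₂ : Set (Cn n)) (f : Cn n → Cn n) : Prop :=
  DifferentiableOn ℂ f D₁ ∧ Set.InjOn f D₁ ∧ Set.MapsTo f D₁ D₂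

/-- The sublevel set `Ω(r) = {z : ρ_Ω(z) < r}` of the Minkowski function
`ρ_Ω(z) = inf {t > 0 : z / t ∈ Ω}`. -/
def sublevel {n : ℕ} (Ω : Set (Cn n)) (r : ℝ) : Set (Cn n) :=
  {z | gauge Ω z < r}

/-- The generalized squeezing function
`s_D^Ω(z) = sup {r : Ω(r) ⊆ f(D), f : D → Ω injective holomorphic, f(z) = 0}`, `0 < r < 1`. -/
def squeezing {n : ℕ} (Ω D : Set (Cn n)) (z : Cn n) : ℝ :=
  sSup {r : ℝ | 0 < r ∧ r < 1 ∧
    ∃ f : Cn n → Cn n, IsInjHol D Ω f ∧ f z = 0 ∧ sublevel Ω r ⊆ f '' D}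

/-- `(D_j)` is a sequence of subdomains of `D` such that every compact subset of `D` is
contained in all but finitely many `D_j`. -/
def Exhausts {n : ℕ} (Dseq : ℕ → Set (Cn n)) (D : Set (Cn n)) : Prop :=
  (∀ j, IsDomainIn (Dseq j) ∧ Dseq j ⊆ D) ∧
    ∀ K : Set (Cn n), IsCompact K → K ⊆ D → ∃ N : ℕ, ∀ j : ℕ, N < j → K ⊆ Dseq j

end GenSqueezing

end

namespace GenSqueezing

section
open Metric Set

/-! ### Cauchy-type estimates and limits of bounded families of holomorphic maps -/

section Holomorphic

/-! The core is joint convergence: squeezing values of the subdomains at `y` tend to that of `D` at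
`z` as the index grows and `y → z` together (`tendsto_squeezing`). Taking `y = z` gives pointwise
convergence; the constant family `D` gives continuity of the limit; together they give locally
uniform, hence compact, convergence.

Lower bound: translate a nearly optimal map on `D` to vanish at `y`, rescale it into `Ω`, and
restrict it. The part of `D` covering a slightly smaller sublevel set is compact, so it eventually
lies in the subdomains (`eventually_mem_squeezingRadii`).

Upper bound: nearly optimal maps `f i` on the subdomains and their inverses `g i` on a sublevel set
`W` are uniformly bounded, so both converge along an ultrafilter, to `φ` and `γ`, together with
their derivatives. The Jacobians of `φ` at `z` and of `γ` at `0` multiply to `1`. Osgood's theorem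
makes the Jacobians of `f i` and `g i` zero-free, and Hurwitz's theorem passes this to the limits. A
uniform open mapping argument then shows that `φ` is injective with values in `Ω` and that `γ` maps
`W` into `D`, whence `φ ∘ γ = id` on `W` (`exists_injHol_limit`).

Osgood's theorem is an induction on dimension. At a singular point with nonzero derivative, slicing
produces a counterexample in lower dimension; so the derivative vanishes on the whole zero set of
the Jacobian. That set then either contains a nonconstant curve, on which the map is constant, or
forces the derivative to vanish on an open set. -/

theorem mapsTo_closedBall_of_norm_le {E F : Type*} [NormedAddCommGroup E] [NormedAddCommGroup F]
    {f : E → F} {x : E} {R M : ℝ} (hR : 0 < R)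
    (hM : ∀ y ∈ ball x R, ‖f y‖ ≤ M) : MapsTo f (ball x R) (closedBall (f x) (2 * M)) := by
  intro y hy
  rw [mem_closedBall, dist_eq_norm]
  linarith [norm_sub_le (f y) (f x), hM y hy, hM x (mem_ball_self hR)]

variable {E F : Type*} [NormedAddCommGroup E] [NormedSpace ℂ E]
  [NormedAddCommGroup F] [NormedSpace ℂ F]

theorem norm_sub_le_of_bounded {f : E → F} {x y : E} {R M : ℝ} (hR : 0 < R)
    (hf : DifferentiableOn ℂ f (ball x R)) (hM : ∀ y ∈ ball x R, ‖f y‖ ≤ M)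
    (hy : y ∈ ball x R) : ‖f y - f x‖ ≤ 2 * M / R * ‖y - x‖ := by
  simpa [dist_eq_norm] using
    Complex.dist_le_div_mul_dist_of_mapsTo_ball hf (mapsTo_closedBall_of_norm_le hR hM) hy

theorem norm_fderiv_le_of_bounded {f : E → F} {x : E} {R M : ℝ} (hR : 0 < R)
    (hf : DifferentiableOn ℂ f (ball x R)) (hM : ∀ y ∈ ball x R, ‖f y‖ ≤ M) :
    ‖fderiv ℂ f x‖ ≤ 2 * M / R :=
  Complex.norm_fderiv_le_div_of_mapsTo_ball hf (mapsTo_closedBall_of_norm_le hR hM) hR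

/-- Second order Taylor estimate for a bounded holomorphic map on a ball. -/
theorem norm_taylor_le_of_bounded {f : E → F} {x y : E} {R M : ℝ} (hR : 0 < R)
    (hf : DifferentiableOn ℂ f (ball x R)) (hM : ∀ y ∈ ball x R, ‖f y‖ ≤ M)
    (hy : y ∈ ball x R) :
    ‖f y - f x - fderiv ℂ f x (y - x)‖ ≤ 4 * M * (‖y - x‖ / R) ^ 2 := by
  have hd : DifferentiableAt ℂ f x := hf.differentiableAt (ball_mem_nhds x hR)
  set A := fderiv ℂ f x with hA
  have hAn := norm_fderiv_le_of_bounded hR hf hM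
  have key := Complex.dist_le_mul_div_pow_of_mapsTo_ball_of_isLittleO
    (f := fun w => f w - A (w - x)) (c := x) (z := y) (R₁ := R) (R₂ := 4 * M) (n := 1)
    (by fun_prop) ?_ ?_ hy
  · rw [dist_eq_norm, dist_eq_norm] at key
    simpa [sub_right_comm] using key
  · intro w hw
    have h1 := mapsTo_closedBall_of_norm_le hR hM hw
    rw [mem_closedBall, dist_eq_norm] at h1 ⊢
    have h2 : ‖A (w - x)‖ ≤ 2 * M := by
      have hw' : ‖w - x‖ ≤ R := by rw [← dist_eq_norm]; exact (mem_ball.1 hw).le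
      calc ‖A (w - x)‖ ≤ ‖A‖ * ‖w - x‖ := A.le_opNorm _
        _ ≤ 2 * M / R * R := by gcongr; exact (norm_nonneg _).trans hAn
        _ = 2 * M := by field_simp
    have h3 : f w - A (w - x) - (f x - A (x - x)) = (f w - f x) - A (w - x) := by
      simp [sub_right_comm]
    rw [h3]
    linarith [norm_sub_le (f w - f x) (A (w - x))]
  · have h := hasFDerivAt_iff_isLittleO.1 hd.hasFDerivAt
    have h' := h.norm_right
    simpa [sub_right_comm] using h'

/-- A family of maps which is eventually holomorphic and uniformly bounded near `x`. -/
def EventuallyHolBdd {ι : Type*} (𝓕 : Filter ι) (f : ι → E → F) (x : E) : Prop :=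
  ∃ R > 0, ∃ M : ℝ, ∀ᶠ i in 𝓕, DifferentiableOn ℂ (f i) (ball x R) ∧ ∀ y ∈ ball x R, ‖f i y‖ ≤ M

/-- The Cauchy estimate makes the family uniformly Lipschitz at `x`, so convergence at the single
point `x` already controls nearby points. -/
theorem EventuallyHolBdd.tendsto_prod {ι : Type*} {𝓕 : Filter ι} {f : ι → E → F} {x : E}
    (hf : EventuallyHolBdd 𝓕 f x) {z : F} (hz : Tendsto (fun i => f i x) 𝓕 (𝓝 z)) :
    Tendsto (fun q : ι × E => f q.1 q.2) (𝓕 ×ˢ 𝓝 x) (𝓝 z) := by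
  obtain ⟨R, hR, M, h⟩ := hf
  have h1 : Tendsto (fun q : ι × E => f q.1 q.2 - f q.1 x) (𝓕 ×ˢ 𝓝 x) (𝓝 0) := by
    have h2 : Tendsto (fun q : ι × E => 2 * M / R * ‖q.2 - x‖) (𝓕 ×ˢ 𝓝 x) (𝓝 0) := by
      have : Tendsto (fun y : E => 2 * M / R * ‖y - x‖) (𝓝 x) (𝓝 (2 * M / R * ‖x - x‖)) :=
        (by fun_prop : Continuous fun y : E => 2 * M / R * ‖y - x‖).tendsto x
      rw [sub_self, norm_zero, mul_zero] at this
      exact this.comp tendsto_snd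
    refine squeeze_zero_norm' ?_ h2
    filter_upwards [h.prod_mk (ball_mem_nhds x hR)] with q hq
    exact norm_sub_le_of_bounded hR hq.1.1 hq.1.2 hq.2
  simpa using h1.add (hz.comp tendsto_fst)

/-- The derivatives at `x` stay in a compact ball, so they converge along the ultrafilter. The
second-order Taylor bound has constants independent of the index and survives the limit, which
identifies the limit operator as the derivative of `φ`. -/
theorem hasFDerivAt_of_ultrafilter_tendsto [FiniteDimensional ℂ E] [FiniteDimensional ℂ F]
    {ι : Type*} {𝓤 : Ultrafilter ι} {f : ι → E → F} {φ : E → F} {x : E}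
    (hf : EventuallyHolBdd 𝓤 f x) (hφ : ∀ᶠ y in 𝓝 x, Tendsto (fun i => f i y) 𝓤 (𝓝 (φ y))) :
    DifferentiableAt ℂ φ x ∧ Tendsto (fun i => fderiv ℂ (f i) x) 𝓤 (𝓝 (fderiv ℂ φ x)) := by
  obtain ⟨R, hR, M, h⟩ := hf
  have : ProperSpace (E →L[ℂ] F) := FiniteDimensional.proper ℂ _
  have hb : ∀ᶠ i in (𝓤 : Filter ι), fderiv ℂ (f i) x ∈ closedBall (0 : E →L[ℂ] F) (2 * M / R) := by
    filter_upwards [h] with i hi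
    simpa using norm_fderiv_le_of_bounded hR hi.1 hi.2
  obtain ⟨A, -, hA⟩ := (isCompact_closedBall (0 : E →L[ℂ] F) (2 * M / R)).ultrafilter_le_nhds'
    (𝓤.map fun i => fderiv ℂ (f i) x) hb
  have hA' : Tendsto (fun i => fderiv ℂ (f i) x) 𝓤 (𝓝 A) := hA
  have hx := hφ.self_of_nhds
  have hd : HasFDerivAt φ A x := by
    rw [hasFDerivAt_iff_isLittleO]
    have hO : (fun y => φ y - φ x - A (y - x)) =O[𝓝 x] fun y => ‖y - x‖ ^ 2 := by
      refine Asymptotics.IsBigO.of_bound (4 * M / R ^ 2) ?_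
      filter_upwards [hφ, ball_mem_nhds x hR] with y hy hyR
      have hlim : Tendsto (fun i => ‖f i y - f i x - fderiv ℂ (f i) x (y - x)‖) 𝓤
          (𝓝 ‖φ y - φ x - A (y - x)‖) :=
        ((hy.sub hx).sub
          (((ContinuousLinearMap.apply ℂ F (y - x)).continuous.tendsto A).comp hA')).norm
      refine le_of_tendsto hlim ?_
      filter_upwards [h] with i hi
      refine (norm_taylor_le_of_bounded hR hi.1 hi.2 hyR).trans (le_of_eq ?_)
      simp
      field_simp
    refine hO.trans_isLittleO ?_
    have h1 : Tendsto (fun y => y - x) (𝓝 x) (𝓝 0) := by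
      have : Tendsto (fun y => y - x) (𝓝 x) (𝓝 (x - x)) :=
        (by fun_prop : Continuous fun y : E => y - x).tendsto x
      rwa [sub_self] at this
    exact (Asymptotics.isLittleO_norm_pow_id one_lt_two).comp_tendsto h1
  exact ⟨hd.differentiableAt, hd.fderiv ▸ hA'⟩

theorem differentiableAt_clm_of_apply [FiniteDimensional ℂ E] {G : Type*} [NormedAddCommGroup G]
    [NormedSpace ℂ G] {A : G → E →L[ℂ] F} {x : G}
    (h : ∀ v, DifferentiableAt ℂ (fun y => A y v) x) : DifferentiableAt ℂ A x := by
  let b := Module.finBasis ℂ E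
  let c : Fin (Module.finrank ℂ E) → StrongDual ℂ E := fun i => LinearMap.toContinuousLinearMap (b.coord i)
  have : A = fun y => ∑ i, ContinuousLinearMap.smulRightL ℂ E F (c i) (A y (b i)) := by
    funext y
    ext v
    conv_lhs => rw [← b.sum_repr v, map_sum]
    simp [c]
  rw [this]
  refine DifferentiableAt.fun_sum fun i _ => ?_
  exact (ContinuousLinearMap.differentiableAt _).comp x (h _)

/-- The derivative of a holomorphic map is holomorphic. -/
theorem differentiableOn_fderiv [FiniteDimensional ℂ E] [FiniteDimensional ℂ F] {f : E → F}
    {U : Set E} (hU : IsOpen U) (hf : DifferentiableOn ℂ f U) :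
    DifferentiableOn ℂ (fderiv ℂ f) U := by
  intro x hx
  refine (differentiableAt_clm_of_apply fun v => ?_).differentiableWithinAt
  obtain ⟨R, hR, hRU⟩ : ∃ R > 0, ball x R ⊆ U ∧ ∀ y ∈ ball x R, ‖f y‖ ≤ ‖f x‖ + 1 := by
    have h1 : ∀ᶠ y in 𝓝 x, y ∈ U ∧ ‖f y‖ ≤ ‖f x‖ + 1 := by
      refine (hU.eventually_mem hx).and ?_
      have := ((hf.differentiableAt (hU.mem_nhds hx)).continuousAt.norm).eventually
        (Iic_mem_nhds (show ‖f x‖ < ‖f x‖ + 1 by linarith))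
      exact this
    obtain ⟨R, hR, h⟩ := Metric.eventually_nhds_iff_ball.1 h1
    exact ⟨R, hR, fun y hy => (h y hy).1, fun y hy => (h y hy).2⟩
  obtain ⟨hRU, hM⟩ := hRU
  set M := ‖f x‖ + 1
  -- The directional derivative is a limit of difference quotients, which are holomorphic in the
  -- base point and bounded by the Lipschitz estimate; the limit lemma therefore applies with the
  -- increment `t` as index.
  let 𝓤 : Ultrafilter ℂ := Ultrafilter.of (𝓝[≠] (0 : ℂ))
  have h𝓤 : (𝓤 : Filter ℂ) ≤ 𝓝[≠] (0 : ℂ) := Ultrafilter.of_le _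
  have hlim : ∀ y ∈ ball x R, Tendsto (fun t : ℂ => t⁻¹ • (f (y + t • v) - f y)) 𝓤
      (𝓝 (fderiv ℂ f y v)) := by
    intro y hy
    have hd : HasFDerivAt f (fderiv ℂ f y) y :=
      (hf.differentiableAt (hU.mem_nhds (hRU hy))).hasFDerivAt
    have h2 : HasDerivAt (fun t : ℂ => f (y + t • v)) (fderiv ℂ f y v) 0 := by
      have h3 : HasDerivAt (fun t : ℂ => y + t • v) v 0 := by
        simpa using ((hasDerivAt_id (0 : ℂ)).smul_const v).const_add y
      have h4 : HasFDerivAt f (fderiv ℂ f y) (y + (0 : ℂ) • v) := by simpa using hd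
      exact h4.comp_hasDerivAt (0 : ℂ) h3
    have := (hasDerivAt_iff_tendsto_slope_zero.1 h2).mono_left h𝓤
    simpa using this
  refine (hasFDerivAt_of_ultrafilter_tendsto (𝓤 := 𝓤)
    (f := fun (t : ℂ) y => t⁻¹ • (f (y + t • v) - f y)) (φ := fun y => fderiv ℂ f y v) ?_ ?_).1
  · refine ⟨R / 2, by positivity, 2 * M / (R / 2) * ‖v‖, ?_⟩
    have hs : ∀ᶠ t in (𝓤 : Filter ℂ), ‖t • v‖ < R / 2 := by
      have : Tendsto (fun t : ℂ => ‖t • v‖) (𝓝 0) (𝓝 ‖(0 : ℂ) • v‖) :=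
        (by fun_prop : Continuous fun t : ℂ => ‖t • v‖).tendsto 0
      rw [zero_smul, norm_zero] at this
      exact h𝓤 (nhdsWithin_le_nhds (this.eventually (Iio_mem_nhds (by positivity))))
    have h0 : ∀ᶠ t in (𝓤 : Filter ℂ), t ≠ 0 := h𝓤 self_mem_nhdsWithin
    filter_upwards [hs, h0] with t ht ht0
    have hy' : ∀ y ∈ ball x (R / 2), y + t • v ∈ ball x R := fun y hy => by
      rw [mem_ball, dist_eq_norm] at hy ⊢
      have : y + t • v - x = (y - x) + t • v := by abel
      rw [this]
      linarith [norm_add_le (y - x) (t • v)]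
    have hsub : ball x (R / 2) ⊆ ball x R := ball_subset_ball (by linarith)
    constructor
    · have h1 : DifferentiableOn ℂ (fun y => f (y + t • v)) (ball x (R / 2)) :=
        (hf.mono hRU).comp (by fun_prop) hy'
      exact (h1.sub ((hf.mono hRU).mono hsub)).const_smul _
    · intro y hy
      have hyR : ball y (R / 2) ⊆ ball x R := by
        refine ball_subset_ball' ?_
        linarith [mem_ball.1 hy]
      have := norm_sub_le_of_bounded (f := f) (x := y) (y := y + t • v) (half_pos hR)
        (hf.mono (hyR.trans hRU)) (fun w hw => hM w (hyR hw)) (by simpa using ht)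
      rw [norm_smul, norm_inv, inv_mul_le_iff₀ (norm_pos_iff.2 ht0)]
      refine this.trans (le_of_eq ?_)
      rw [add_sub_cancel_left, norm_smul]
      ring
  · exact eventually_of_mem (ball_mem_nhds x hR) hlim

theorem EventuallyHolBdd.fderiv [FiniteDimensional ℂ E] [FiniteDimensional ℂ F]
    {ι : Type*} {𝓕 : Filter ι} {f : ι → E → F} {x : E}
    (hf : EventuallyHolBdd 𝓕 f x) : EventuallyHolBdd 𝓕 (fun i => fderiv ℂ (f i)) x := by
  obtain ⟨R, hR, M, h⟩ := hf
  refine ⟨R / 2, half_pos hR, 2 * M / (R / 2), ?_⟩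
  filter_upwards [h] with i hi
  refine ⟨(differentiableOn_fderiv isOpen_ball hi.1).mono (ball_subset_ball (by linarith)), ?_⟩
  intro y hy
  have hyR : ball y (R / 2) ⊆ ball x R := ball_subset_ball' (by linarith [mem_ball.1 hy])
  exact norm_fderiv_le_of_bounded (half_pos hR) (hi.1.mono hyR) fun w hw => hi.2 w (hyR hw)

theorem hasStrictFDerivAt_of_differentiableOn [FiniteDimensional ℂ E] [FiniteDimensional ℂ F]
    {f : E → F} {U : Set E} (hU : IsOpen U) (hf : DifferentiableOn ℂ f U) {x : E} (hx : x ∈ U) :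
    HasStrictFDerivAt f (_root_.fderiv ℂ f x) x :=
  hasStrictFDerivAt_of_hasFDerivAt_of_continuousAt
    ((hU.eventually_mem hx).mono fun _ hy => (hf.differentiableAt (hU.mem_nhds hy)).hasFDerivAt)
    ((differentiableOn_fderiv hU hf).differentiableAt (hU.mem_nhds hx)).continuousAt

theorem contDiffOn_one_of_differentiableOn [FiniteDimensional ℂ E] [FiniteDimensional ℂ F]
    {f : E → F} {U : Set E} (hU : IsOpen U) (hf : DifferentiableOn ℂ f U) : ContDiffOn ℂ 1 f U := by
  have := (contDiffOn_succ_iff_fderiv_of_isOpen (𝕜 := ℂ) (n := 0) (f := f) hU).2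
    ⟨hf, by simp, contDiffOn_zero.2 (differentiableOn_fderiv hU hf).continuousOn⟩
  simpa using this

theorem differentiable_det [FiniteDimensional ℂ E] :
    Differentiable ℂ fun A : E →L[ℂ] E => A.det := by
  let b := Module.finBasis ℂ E
  have : (fun A : E →L[ℂ] E => A.det) = fun A => ∑ σ : Equiv.Perm (Fin (Module.finrank ℂ E)),
      (Equiv.Perm.sign σ : ℂ) *
        ∏ i, LinearMap.toContinuousLinearMap (b.coord (σ i)) (A (b i)) := by
    funext A
    rw [ContinuousLinearMap.det, ← LinearMap.det_toMatrix b, Matrix.det_apply']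
    simp [LinearMap.toMatrix_apply]
  rw [this]
  refine Differentiable.fun_sum fun σ _ => Differentiable.const_mul ?_ _
  have : ∀ s : Finset (Fin (Module.finrank ℂ E)), Differentiable ℂ fun A : E →L[ℂ] E =>
      ∏ i ∈ s, LinearMap.toContinuousLinearMap (b.coord (σ i)) (A (b i)) := by
    intro s
    induction s using Finset.induction_on with
    | empty => simp
    | insert i s hi ih =>
      simp only [Finset.prod_insert hi]
      exact Differentiable.mul (by fun_prop) ih
  exact this _

end Holomorphic

/-! ### Hurwitz's theorem -/

section Hurwitz

/-- Without a zero, the maximum principle for `1/φ` would bound `‖φ 0‖` below by `m`. -/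
theorem exists_zero_of_norm_lt {φ : ℂ → ℂ} {τ m : ℝ} (hτ : 0 < τ)
    (hφ : DiffContOnCl ℂ φ (ball 0 τ)) (hm : ∀ t ∈ sphere (0 : ℂ) τ, m ≤ ‖φ t‖)
    (h0 : ‖φ 0‖ < m) : ∃ t ∈ closedBall (0 : ℂ) τ, φ t = 0 := by
  by_contra! hne
  have hcl : closure (ball (0 : ℂ) τ) = closedBall 0 τ := closure_ball _ hτ.ne'
  have hm0 : 0 < m := (norm_nonneg _).trans_lt h0
  have h := Complex.norm_le_of_forall_mem_frontier_norm_le (C := m⁻¹) isBounded_ball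
    (hφ.inv (hcl ▸ hne)) (fun z hz => by
      rw [frontier_ball _ hτ.ne'] at hz
      simpa using inv_anti₀ hm0 (hm z hz)) (z := 0) (hcl ▸ mem_closedBall_self hτ.le)
  rw [Pi.inv_apply, norm_inv] at h
  have h2 : 0 < ‖φ 0‖ := norm_pos_iff.2 (hne 0 (mem_closedBall_self hτ.le))
  exact absurd ((inv_le_inv₀ h2 hm0).1 h) (not_le.2 h0)

theorem eventually_exists_zero {ι : Type*} {𝓕 : Filter ι} {φ : ι → ℂ → ℂ} {ψ : ℂ → ℂ} {τ : ℝ}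
    (hτ : 0 < τ) (hφ : ∀ᶠ i in 𝓕, DiffContOnCl ℂ (φ i) (ball 0 τ))
    (hlim : ∀ t ∈ closedBall (0 : ℂ) τ,
      Tendsto (fun q : ι × ℂ => φ q.1 q.2) (𝓕 ×ˢ 𝓝 t) (𝓝 (ψ t)))
    (hψ : ContinuousOn ψ (sphere 0 τ)) (h0 : ψ 0 = 0) (hne : ∀ t ∈ sphere (0 : ℂ) τ, ψ t ≠ 0) :
    ∀ᶠ i in 𝓕, ∃ t ∈ closedBall (0 : ℂ) τ, φ i t = 0 := by
  obtain ⟨t₀, ht₀, hmin⟩ := (isCompact_sphere (0 : ℂ) τ).exists_isMinOn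
    (NormedSpace.sphere_nonempty.2 hτ.le) hψ.norm
  set m := ‖ψ t₀‖
  have hm : 0 < m := norm_pos_iff.2 (hne t₀ ht₀)
  have h1 : ∀ᶠ i in 𝓕, ‖φ i 0‖ < m / 2 := by
    have h2 := (hlim 0 (mem_closedBall_self hτ.le)).norm
    rw [h0, norm_zero] at h2
    have h3 : Tendsto (fun i => (i, (0 : ℂ))) 𝓕 (𝓕 ×ˢ 𝓝 0) :=
      tendsto_id.prodMk tendsto_const_nhds
    exact (h2.comp h3).eventually (Iio_mem_nhds (half_pos hm))
  have h2 : ∀ᶠ i in 𝓕, ∀ t ∈ sphere (0 : ℂ) τ, m / 2 ≤ ‖φ i t‖ := by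
    refine (isCompact_sphere (0 : ℂ) τ).induction_on
      (p := fun s => ∀ᶠ i in 𝓕, ∀ t ∈ s, m / 2 ≤ ‖φ i t‖) (by simp)
      (fun s t hst h => h.mono fun i hi u hu => hi u (hst hu))
      (fun s t hs ht => by
        filter_upwards [hs, ht] with i h1 h2 u hu
        exact hu.elim (h1 u) (h2 u)) ?_
    intro t ht
    have h3 := (hlim t (sphere_subset_closedBall ht)).norm.eventually
      (Ioi_mem_nhds (show m / 2 < ‖ψ t‖ from (half_lt_self hm).trans_le (hmin ht)))
    obtain ⟨P, hP, Q, hQ, h4⟩ := eventually_prod_iff.1 h3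
    exact ⟨{y | Q y}, mem_nhdsWithin_of_mem_nhds hQ, hP.mono fun i hi t ht => le_of_lt (h4 hi ht)⟩
  filter_upwards [h1, h2, hφ] with i hi1 hi2 hi3
  exact exists_zero_of_norm_lt hτ hi3 hi2 hi1

variable {E : Type*} [NormedAddCommGroup E] [NormedSpace ℂ E]

/-- Hurwitz's theorem for families converging along a filter on a connected open set. -/
theorem ne_zero_of_tendsto_of_ne_zero {ι : Type*} {𝓕 : Filter ι} [NeBot 𝓕]
    {h : ι → E → ℂ} {k : E → ℂ} {D : Set E} (hD : IsOpen D) (hDc : IsPreconnected D)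
    (hk : DifferentiableOn ℂ k D)
    (hhol : ∀ x ∈ D, ∃ R > 0, ∀ᶠ i in 𝓕, DifferentiableOn ℂ (h i) (ball x R) ∧
      ∀ y ∈ ball x R, h i y ≠ 0)
    (hlim : ∀ x ∈ D, Tendsto (fun q : ι × E => h q.1 q.2) (𝓕 ×ˢ 𝓝 x) (𝓝 (k x)))
    (hne : ∃ x ∈ D, k x ≠ 0) : ∀ x ∈ D, k x ≠ 0 := by
  have hopen : IsOpen (D ∩ k ⁻¹' {0}ᶜ) :=
    hk.continuousOn.isOpen_inter_preimage hD isOpen_compl_singleton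
  suffices hsub : D ⊆ D ∩ k ⁻¹' {0}ᶜ from fun x hx => (hsub hx).2
  -- Connectedness reduces the claim to relative closedness of the nonvanishing set. A limit point
  -- `p` with `k p = 0` is joined by a complex line to a nearby `q` with `k q ≠ 0`; the zero at `p`
  -- is isolated on that line, so the approximating functions must vanish nearby.
  refine hDc.subset_of_closure_inter_subset hopen ?_ ?_
  · obtain ⟨x, hx, hx'⟩ := hne
    exact ⟨x, hx, hx, hx'⟩
  rintro p ⟨hpc, hpD⟩
  refine ⟨hpD, fun hp0 => ?_⟩
  have hp0 : k p = 0 := hp0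
  obtain ⟨R₁, hR₁, hhol⟩ := hhol p hpD
  obtain ⟨R₂, hR₂, hball⟩ := Metric.isOpen_iff.1 hD p hpD
  set R := min R₁ R₂
  have hR : 0 < R := lt_min hR₁ hR₂
  obtain ⟨q, ⟨hqD, hq0⟩, hqR⟩ := Metric.mem_closure_iff.1 hpc R hR
  have hq0 : k q ≠ 0 := hq0
  set v := q - p
  have hv : v ≠ 0 := by
    intro h0
    rw [sub_eq_zero] at h0
    exact hq0 (h0 ▸ hp0)
  have hv' : 0 < ‖v‖ := norm_pos_iff.2 hv
  have hvR : ‖v‖ < R := by rwa [← dist_eq_norm, dist_comm]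
  set ℓ : ℂ → E := fun t => p + t • v
  have hℓ : Differentiable ℂ ℓ := by fun_prop
  have hmaps : ∀ t ∈ ball (0 : ℂ) (R / ‖v‖), ℓ t ∈ ball p R := by
    intro t ht
    rw [mem_ball_zero_iff, lt_div_iff₀ hv'] at ht
    simpa [ℓ, norm_smul] using ht
  have hψ : DifferentiableOn ℂ (k ∘ ℓ) (ball 0 (R / ‖v‖)) :=
    hk.comp hℓ.differentiableOn fun t ht =>
      hball (ball_subset_ball (min_le_right _ _) (hmaps t ht))
  have hRv : 1 < R / ‖v‖ := by rwa [one_lt_div hv']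
  have han := hψ.analyticOnNhd isOpen_ball
  have hiso : ∀ᶠ t in 𝓝[≠] (0 : ℂ), (k ∘ ℓ) t ≠ 0 := by
    rcases (han 0 (mem_ball_self (by positivity))).eventually_eq_zero_or_eventually_ne_zero
      with h | h
    · exfalso
      have := han.eqOn_zero_of_preconnected_of_eventuallyEq_zero
        (convex_ball _ _).isPreconnected (mem_ball_self (by positivity)) h
        (show (1 : ℂ) ∈ ball (0 : ℂ) (R / ‖v‖) by simpa using hRv)
      exact hq0 (by simpa [ℓ, v] using this)
    · exact h
  obtain ⟨ε, hε, hε'⟩ := Metric.eventually_nhds_iff_ball.1 (eventually_nhdsWithin_iff.1 hiso)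
  -- Below `ε` the circle avoids the other zeros; at most `1 < R / ‖v‖` keeps the closed disc where
  -- `ℓ` stays in the ball.
  set τ := min (ε / 2) 1
  have hτ : 0 < τ := lt_min (half_pos hε) one_pos
  have hτε : τ < ε := (min_le_left _ _).trans_lt (half_lt_self hε)
  have hτR : τ < R / ‖v‖ := (min_le_right _ _).trans_lt hRv
  have hcb : closedBall (0 : ℂ) τ ⊆ ball 0 (R / ‖v‖) := closedBall_subset_ball hτR
  have hev := eventually_exists_zero (𝓕 := 𝓕) (φ := fun i => h i ∘ ℓ) (ψ := k ∘ ℓ) hτ ?_ ?_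
    (hψ.continuousOn.mono (sphere_subset_closedBall.trans hcb)) (by simpa [ℓ] using hp0) ?_
  · obtain ⟨i, ⟨t, ht, ht0⟩, hi⟩ := (hev.and hhol).exists
    exact hi.2 _ (ball_subset_ball (min_le_left _ _) (hmaps t (hcb ht))) ht0
  · filter_upwards [hhol] with i hi
    refine DifferentiableOn.diffContOnCl (hi.1.comp hℓ.differentiableOn fun t ht => ?_)
    rw [closure_ball _ hτ.ne'] at ht
    exact ball_subset_ball (min_le_left _ _) (hmaps t (hcb ht))
  · intro t ht
    have h1 := hlim (ℓ t) (hball (ball_subset_ball (min_le_right _ _) (hmaps t (hcb ht))))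
    exact h1.comp (tendsto_id.prodMap (hℓ.continuous.tendsto t))
  · intro t ht
    refine hε' t ?_ ?_
    · rw [mem_ball, mem_sphere.1 ht]; exact hτε
    · rintro rfl
      rw [mem_sphere, dist_self] at ht
      exact hτ.ne ht

end Hurwitz

end

end GenSqueezing

/-! ### Injectivity and Jacobians: dimension one, and derivatives vanishing with the Jacobian -/

namespace GenSqueezing

section
open Metric Set

/-- The inverse is continuous by the open mapping theorem and holomorphic away from `φ a`, since
zeros of `deriv φ` are isolated. Its singularity at `φ a` is removable, and the chain rule then
contradicts `deriv φ a = 0`. -/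
theorem deriv_ne_zero_of_injOn {φ : ℂ → ℂ} {U : Set ℂ} (hU : IsOpen U)
    (hφ : DifferentiableOn ℂ φ U) (hinj : InjOn φ U) {a : ℂ} (ha : a ∈ U) : deriv φ a ≠ 0 := by
  intro hda
  have hnc : ∀ x ∈ U, ¬ ∀ᶠ z in 𝓝 x, φ z = φ x := by
    intro x hx h
    have h1 : ∀ᶠ z in 𝓝[≠] x, z ∈ U ∧ φ z = φ x :=
      nhdsWithin_le_nhds ((hU.eventually_mem hx).and h)
    obtain ⟨z, ⟨hzU, hz⟩, hzx⟩ := (h1.and self_mem_nhdsWithin).exists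
    exact hzx (hinj hzU hx hz)
  have hopen : ∀ x ∈ U, 𝓝 (φ x) ≤ map φ (𝓝 x) := fun x hx =>
    ((hφ.analyticAt (hU.mem_nhds hx)).eventually_constant_or_nhds_le_map_nhds).resolve_left
      (hnc x hx)
  set ψ := Function.invFunOn φ U
  have hψ : ∀ x ∈ U, ψ (φ x) = x := fun x hx => hinj.leftInvOn_invFunOn hx
  have hψc : ∀ x ∈ U, ContinuousAt ψ (φ x) := by
    intro x hx
    rw [ContinuousAt, hψ x hx]
    refine (tendsto_map'_iff.2 ?_).mono_left (hopen x hx)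
    exact tendsto_id.congr' ((hU.eventually_mem hx).mono fun z hz => (hψ z hz).symm)
  have hφψ : ∀ x ∈ U, ∀ᶠ w in 𝓝 (φ x), ∃ z ∈ U, φ z = w := fun x hx =>
    hopen x hx ((hU.eventually_mem hx).mono fun z hz => ⟨z, hz, rfl⟩)
  have hψd : ∀ x ∈ U, deriv φ x ≠ 0 → DifferentiableAt ℂ ψ (φ x) := by
    intro x hx hne
    have h1 : HasDerivAt φ (deriv φ x) (ψ (φ x)) := by
      rw [hψ x hx]
      exact (hφ.differentiableAt (hU.mem_nhds hx)).hasDerivAt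
    refine (h1.of_local_left_inverse (hψc x hx) hne ?_).differentiableAt
    filter_upwards [hφψ x hx] with w hw
    obtain ⟨z, hz, rfl⟩ := hw
    rw [hψ z hz]
  have hd' : ∀ᶠ z in 𝓝[≠] a, deriv φ z ≠ 0 := by
    rcases ((hφ.deriv hU).analyticAt (hU.mem_nhds ha)).eventually_eq_zero_or_eventually_ne_zero
      with h | h
    · exfalso
      obtain ⟨R, hR, hb⟩ := Metric.eventually_nhds_iff_ball.1 (h.and (hU.eventually_mem ha))
      refine hnc a ha (eventually_of_mem (ball_mem_nhds a hR) fun z hz => ?_)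
      have := (convex_ball a R).norm_image_sub_le_of_norm_deriv_le (𝕜 := ℂ) (f := φ) (C := 0)
        (fun w hw => hφ.differentiableAt (hU.mem_nhds (hb w hw).2))
        (fun w hw => by rw [(hb w hw).1, norm_zero]) (mem_ball_self hR) hz
      rw [zero_mul] at this
      exact sub_eq_zero.1 (norm_le_zero_iff.1 this)
    · exact h
  have han : AnalyticAt ℂ ψ (φ a) := by
    refine Complex.analyticAt_of_differentiable_on_punctured_nhds_of_continuousAt ?_ (hψc a ha)
    rw [eventually_nhdsWithin_iff]
    have h1 : ∀ᶠ z in 𝓝 a, φ z ≠ φ a → DifferentiableAt ℂ ψ (φ z) := by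
      filter_upwards [eventually_nhdsWithin_iff.1 hd', hU.eventually_mem ha] with z hz hzU hne
      exact hψd z hzU (hz fun h => hne (by rw [h]))
    exact hopen a ha h1
  have h1 : HasDerivAt (ψ ∘ φ) (deriv ψ (φ a) * deriv φ a) a :=
    han.differentiableAt.hasDerivAt.comp a (hφ.differentiableAt (hU.mem_nhds ha)).hasDerivAt
  have h2 : HasDerivAt (ψ ∘ φ) 1 a := (hasDerivAt_id a).congr_of_eventuallyEq
    ((hU.eventually_mem ha).mono fun z hz => hψ z hz)
  have := h1.unique h2
  rw [hda, mul_zero] at this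
  exact zero_ne_one this

section Osgood

theorem not_injOn_of_eventually_fderiv_eq_zero {E F : Type*} [NormedAddCommGroup E]
    [NormedSpace ℂ E] [Nontrivial E] [NormedAddCommGroup F] [NormedSpace ℂ F] {f : E → F} {U : Set E} (hU : IsOpen U)
    (hf : DifferentiableOn ℂ f U) {a : E} (ha : a ∈ U) (h : ∀ᶠ x in 𝓝 a, fderiv ℂ f x = 0) :
    ¬ InjOn f U := by
  intro hinj
  obtain ⟨R, hR, hb⟩ := Metric.eventually_nhds_iff_ball.1 (h.and (hU.eventually_mem ha))
  obtain ⟨v, hv⟩ := exists_ne (0 : E)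
  have hv' : 0 < ‖v‖ := norm_pos_iff.2 hv
  set w := a + ((R / 2 / ‖v‖ : ℝ) : ℂ) • v
  have hw : w ∈ ball a R := by
    rw [mem_ball, dist_eq_norm, add_sub_cancel_left, norm_smul, Complex.norm_real,
      Real.norm_of_nonneg (by positivity), div_mul_cancel₀ _ hv'.ne']
    linarith
  have := (convex_ball a R).norm_image_sub_le_of_norm_fderiv_le (𝕜 := ℂ) (f := f) (C := 0)
    (fun w hw => hf.differentiableAt (hU.mem_nhds (hb w hw).2))
    (fun w hw => by rw [(hb w hw).1, norm_zero]) (mem_ball_self hR) hw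
  rw [zero_mul] at this
  have hwa := hinj (hb w hw).2 ha (sub_eq_zero.1 (norm_le_zero_iff.1 this))
  rw [add_eq_left, smul_eq_zero] at hwa
  rcases hwa with h1 | h1
  · rw [Complex.ofReal_eq_zero] at h1
    exact (by positivity : R / 2 / ‖v‖ ≠ 0) h1
  · exact hv h1

variable {E : Type} [NormedAddCommGroup E] [NormedSpace ℂ E] [FiniteDimensional ℂ E]

/-- By `hZ` the derivative of `G` also vanishes on `Z`, so the inductive bound applies to it and the
mean value inequality gains one power. The target space is quantified inside the induction because
it changes to `E →L[ℂ] F`. -/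
theorem exists_norm_le_mul_pow_of_vanishing {U Z : Set E} (hU : IsOpen U) (hZU : Z ⊆ U)
    (hZ : ∀ (F : Type) [NormedAddCommGroup F] [NormedSpace ℂ F] [FiniteDimensional ℂ F]
      (H : E → F), DifferentiableOn ℂ H U → (∀ x ∈ Z, H x = 0) → ∀ x ∈ Z, fderiv ℂ H x = 0)
    {p : E} (hp : p ∈ Z) (k : ℕ) :
    ∀ (F : Type) [NormedAddCommGroup F] [NormedSpace ℂ F] [FiniteDimensional ℂ F]
      (G : E → F), DifferentiableOn ℂ G U → (∀ x ∈ Z, G x = 0) →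
      ∃ C : ℝ, ∀ᶠ w in 𝓝 p, ‖G w‖ ≤ C * ‖w - p‖ ^ k := by
  induction k with
  | zero =>
    intro F _ _ _ G hG hG0
    refine ⟨1, ?_⟩
    have h := (hG.differentiableAt (hU.mem_nhds (hZU hp))).continuousAt.norm
    rw [ContinuousAt, hG0 p hp, norm_zero] at h
    simpa using (h.eventually (Iio_mem_nhds one_pos)).mono fun w hw => le_of_lt hw
  | succ k ih =>
    intro F _ _ _ G hG hG0
    obtain ⟨C, hC⟩ := ih (E →L[ℂ] F) (fderiv ℂ G) (differentiableOn_fderiv hU hG) (hZ F G hG hG0)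
    refine ⟨|C|, ?_⟩
    obtain ⟨R, hR, hb⟩ := Metric.eventually_nhds_iff_ball.1 (hC.and (hU.eventually_mem (hZU hp)))
    filter_upwards [ball_mem_nhds p hR] with w hw
    have hsub : closedBall p ‖w - p‖ ⊆ ball p R :=
      closedBall_subset_ball (by rwa [← dist_eq_norm])
    have := (convex_closedBall p ‖w - p‖).norm_image_sub_le_of_norm_fderiv_le (𝕜 := ℂ) (f := G)
      (C := |C| * ‖w - p‖ ^ k) (x := p) (y := w)
      (fun y hy => hG.differentiableAt (hU.mem_nhds (hb y (hsub hy)).2))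
      (fun y hy => by
        have hy' : ‖y - p‖ ≤ ‖w - p‖ := by rw [← dist_eq_norm]; exact hy
        refine ((hb y (hsub hy)).1).trans ?_
        gcongr
        exact le_abs_self C)
      (mem_closedBall_self (norm_nonneg _)) (by rw [mem_closedBall, dist_eq_norm])
    rwa [hG0 p hp, sub_zero, mul_assoc, ← pow_succ] at this

/-- If all holomorphic maps vanishing on `Z` have vanishing derivative on `Z`, they vanish
near `Z`. -/
theorem eventually_eq_zero_of_vanishing {U Z : Set E} (hU : IsOpen U) (hZU : Z ⊆ U)
    (hZ : ∀ (F : Type) [NormedAddCommGroup F] [NormedSpace ℂ F] [FiniteDimensional ℂ F]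
      (H : E → F), DifferentiableOn ℂ H U → (∀ x ∈ Z, H x = 0) → ∀ x ∈ Z, fderiv ℂ H x = 0)
    {p : E} (hp : p ∈ Z) {F : Type} [NormedAddCommGroup F] [NormedSpace ℂ F]
    [FiniteDimensional ℂ F] {G : E → F} (hG : DifferentiableOn ℂ G U) (hG0 : ∀ x ∈ Z, G x = 0) :
    ∀ᶠ w in 𝓝 p, G w = 0 := by
  have hc := (hG.differentiableAt (hU.mem_nhds (hZU hp))).continuousAt.norm
  rw [ContinuousAt, hG0 p hp, norm_zero] at hc
  obtain ⟨R, hR, hb⟩ := Metric.eventually_nhds_iff_ball.1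
    ((hU.eventually_mem (hZU hp)).and (hc.eventually (Iio_mem_nhds one_pos)))
  filter_upwards [ball_mem_nhds p hR] with w hw
  -- The Schwarz lemma replaces the uncontrolled constant `C` by the bound `1` on a ball whose
  -- radius does not depend on `n`; letting `n → ∞` kills `G w`.
  have hest : ∀ n : ℕ, ‖G w‖ ≤ 1 * (dist w p / R) ^ (n + 1) := by
    intro n
    obtain ⟨C, hC⟩ := exists_norm_le_mul_pow_of_vanishing hU hZU hZ hp (n + 1) F G hG hG0
    have := Complex.dist_le_mul_div_pow_of_mapsTo_ball_of_isLittleO (f := G) (c := p) (z := w)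
      (R₁ := R) (R₂ := 1) (n := n) (hG.mono fun y hy => (hb y hy).1)
      (fun y hy => by
        rw [hG0 p hp, mem_closedBall_zero_iff]
        exact le_of_lt (hb y hy).2) ?_ hw
    · rwa [hG0 p hp, dist_zero_right] at this
    · simp only [hG0 p hp, sub_zero]
      have hO : G =O[𝓝 p] fun w => ‖w - p‖ ^ (n + 1) :=
        Asymptotics.IsBigO.of_bound C (hC.mono fun y hy => by simpa using hy)
      refine hO.trans_isLittleO ?_
      have h1 : Tendsto (fun y => ‖y - p‖) (𝓝 p) (𝓝 0) := by
        have : Tendsto (fun y => ‖y - p‖) (𝓝 p) (𝓝 ‖p - p‖) :=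
          (by fun_prop : Continuous fun y : E => ‖y - p‖).tendsto p
        rwa [sub_self, norm_zero] at this
      exact (Asymptotics.isLittleO_pow_pow (𝕜 := ℝ) (Nat.lt_succ_self n)).comp_tendsto h1
  have hlt : dist w p / R < 1 := (div_lt_one hR).2 hw
  have hlim : Tendsto (fun n : ℕ => 1 * (dist w p / R) ^ (n + 1)) atTop (𝓝 0) := by
    simpa using (tendsto_add_atTop_iff_nat 1).2
      (tendsto_pow_atTop_nhds_zero_of_lt_one (by positivity) hlt)
  exact norm_le_zero_iff.1 (ge_of_tendsto' hlim hest)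

/-- A holomorphic map whose derivative vanishes wherever its Jacobian determinant does has
nonvanishing Jacobian if it is injective. -/
theorem det_fderiv_ne_zero_of_injOn_of_fderiv_eq_zero {U : Set E} (hU : IsOpen U) {f : E → E}
    (hf : DifferentiableOn ℂ f U) (hinj : InjOn f U)
    (hZ : ∀ x ∈ U, (fderiv ℂ f x).det = 0 → fderiv ℂ f x = 0)
    (hE : 1 < Module.finrank ℂ E) : ∀ x ∈ U, (fderiv ℂ f x).det ≠ 0 := by
  intro a haU ha0
  have : Nontrivial E := Module.nontrivial_of_finrank_pos (R := ℂ) (by omega)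
  set Z : Set E := {x | x ∈ U ∧ (fderiv ℂ f x).det = 0} with hZdef
  have hhol : DifferentiableOn ℂ (fun x => (fderiv ℂ f x).det) U :=
    Differentiable.comp_differentiableOn (g := fun A : E →L[ℂ] E => A.det) differentiable_det
      (differentiableOn_fderiv hU hf)
  -- If no such `H` existed, the vanishing criterion applied to `fderiv ℂ f` itself would make `f`
  -- constant near `a`.
  obtain ⟨F, iF1, iF2, iF3, H, hH, hH0, p, hp, hpne⟩ : ∃ (F : Type) (_ : NormedAddCommGroup F)
      (_ : NormedSpace ℂ F) (_ : FiniteDimensional ℂ F) (H : E → F), DifferentiableOn ℂ H U ∧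
      (∀ x ∈ Z, H x = 0) ∧ ∃ p ∈ Z, fderiv ℂ H p ≠ 0 := by
    by_contra! hcon
    refine not_injOn_of_eventually_fderiv_eq_zero hU hf haU ?_ hinj
    exact eventually_eq_zero_of_vanishing hU (Z := Z) (fun x hx => hx.1)
      (fun F i1 i2 i3 H h1 h2 => hcon F i1 i2 i3 H h1 h2) ⟨haU, ha0⟩
      (differentiableOn_fderiv hU hf) (fun x hx => hZ x hx.1 hx.2)
  set A := fderiv ℂ H p
  obtain ⟨v, hv⟩ : ∃ v, A v ≠ 0 := by
    by_contra! h
    exact hpne (ContinuousLinearMap.ext h)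
  have hv0 : v ≠ 0 := by rintro rfl; exact hv (map_zero A)
  have hvn : 0 < ‖v‖ := norm_pos_iff.2 hv0
  have hAv : 0 < ‖A v‖ := norm_pos_iff.2 hv
  obtain ⟨w, hw⟩ : ∃ w : E, w ∉ Submodule.span ℂ {v} := by
    by_contra! h
    have h1 : Submodule.span ℂ {v} = ⊤ := (Submodule.eq_top_iff').2 h
    have h2 := finrank_span_singleton (K := ℂ) hv0
    rw [h1, finrank_top] at h2
    omega
  -- Chosen so that `ε * ‖v‖ = ‖A v‖ / 2`: the error in the `v` direction is absorbed, and `Z` meets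
  -- the plane through `p` spanned by `w` and `v` in a Lipschitz graph over the `w` coordinate, with
  -- constant `C` below.
  set ε : ℝ := ‖A v‖ / (2 * ‖v‖) with hε
  have hε0 : 0 < ε := by positivity
  have hstrict := (hasStrictFDerivAt_of_differentiableOn hU hH hp.1).isLittleO.bound hε0
  rw [nhds_prod_eq, eventually_prod_self_iff'] at hstrict
  obtain ⟨ρ, hρ, hb⟩ : ∃ ρ > 0, ∀ x ∈ ball p ρ, x ∈ U ∧ ∀ y ∈ ball p ρ,
      ‖H x - H y - A (x - y)‖ ≤ ε * ‖x - y‖ := by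
    obtain ⟨t, ht, hts⟩ := hstrict
    obtain ⟨ρ, hρ, h⟩ := Metric.mem_nhds_iff.1 (inter_mem ht (hU.mem_nhds hp.1))
    exact ⟨ρ, hρ, fun x hx => ⟨(h hx).2, fun y hy => hts x (h hx).1 y (h hy).1⟩⟩
  set C : ℝ := 2 * (‖A‖ + ε) * ‖w‖ / ‖A v‖ with hC
  set X : ℂ → ℂ → E := fun s t => p + s • w + t • v with hX
  have hXc : Continuous fun q : ℂ × ℂ => X q.1 q.2 := by fun_prop
  have hlip : ∀ s t s' t', X s t ∈ Z ∩ ball p ρ → X s' t' ∈ Z ∩ ball p ρ →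
      ‖t - t'‖ ≤ C * ‖s - s'‖ := by
    intro s t s' t' h h'
    have h1 := (hb _ h.2).2 _ h'.2
    rw [hH0 _ h.1, hH0 _ h'.1, sub_zero, zero_sub, norm_neg] at h1
    have h2 : X s t - X s' t' = (s - s') • w + (t - t') • v := by simp only [hX]; module
    rw [h2, map_add, map_smul, map_smul] at h1
    have h3 : ‖(t - t') • A v‖ ≤ ‖(s - s') • A w + (t - t') • A v‖ + ‖(s - s') • A w‖ := by
      have := norm_sub_le ((s - s') • A w + (t - t') • A v) ((s - s') • A w)
      rwa [add_sub_cancel_left] at this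
    have h4 : ‖(s - s') • w + (t - t') • v‖ ≤ ‖s - s'‖ * ‖w‖ + ‖t - t'‖ * ‖v‖ := by
      rw [← norm_smul, ← norm_smul]; exact norm_add_le _ _
    have h5 : ‖A w‖ ≤ ‖A‖ * ‖w‖ := A.le_opNorm w
    rw [norm_smul, norm_smul] at h3
    have h6 : ε * ‖v‖ = ‖A v‖ / 2 := by rw [hε]; field_simp
    have h7 : ‖s - s'‖ * ‖A w‖ ≤ ‖s - s'‖ * (‖A‖ * ‖w‖) := by gcongr
    have h8 := mul_le_mul_of_nonneg_left h4 hε0.le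
    have h9 : ‖t - t'‖ * (ε * ‖v‖) = ‖t - t'‖ * (‖A v‖ / 2) := by rw [h6]
    rw [hC, div_mul_eq_mul_div, le_div_iff₀ hAv]
    nlinarith
  have hX00 : X 0 0 = p := by simp [hX]
  obtain ⟨τ, hτ, hτρ⟩ : ∃ τ > 0, ∀ t ∈ closedBall (0 : ℂ) τ, X 0 t ∈ ball p ρ := by
    refine ⟨ρ / (2 * ‖v‖), by positivity, fun t ht => ?_⟩
    rw [mem_closedBall_zero_iff, le_div_iff₀ (by positivity)] at ht
    have : X 0 t - p = t • v := by simp [hX]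
    rw [mem_ball, dist_eq_norm, this, norm_smul]
    linarith
  have hnhds : ∀ᶠ s in 𝓝 (0 : ℂ), ∀ t ∈ closedBall (0 : ℂ) τ, X s t ∈ ball p ρ := by
    refine (isCompact_closedBall (0 : ℂ) τ).eventually_forall_of_forall_eventually fun t ht => ?_
    exact (hXc.tendsto (0, t)).eventually (isOpen_ball.mem_nhds (hτρ t ht))
  -- On the line `s = 0` the graph estimate leaves `t = 0` as the only zero, so the zero persists
  -- for small `s` by Hurwitz.
  have hzero : ∀ᶠ s in 𝓝 (0 : ℂ), ∃ t ∈ closedBall (0 : ℂ) τ, (fderiv ℂ f (X s t)).det = 0 := by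
    refine eventually_exists_zero (φ := fun s t => (fderiv ℂ f (X s t)).det)
      (ψ := fun t => (fderiv ℂ f (X 0 t)).det) hτ ?_ ?_ ?_ ?_ ?_
    · filter_upwards [hnhds] with s hs
      refine DifferentiableOn.diffContOnCl ?_
      rw [closure_ball _ hτ.ne']
      exact hhol.comp (by fun_prop) fun t ht => (hb _ (hs t ht)).1
    · intro t ht
      have h1 : ContinuousAt (fun x => (fderiv ℂ f x).det) (X 0 t) :=
        (hhol.differentiableAt (hU.mem_nhds (hb _ (hτρ t ht)).1)).continuousAt
      rw [← nhds_prod_eq]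
      exact h1.tendsto.comp (hXc.tendsto (0, t))
    · exact hhol.continuousOn.comp (by fun_prop)
        fun t ht => (hb _ (hτρ t (sphere_subset_closedBall ht))).1
    · simpa [hX00] using hp.2
    · intro t ht h0
      have hm := hτρ t (sphere_subset_closedBall ht)
      have := hlip 0 t 0 0 ⟨⟨(hb _ hm).1, h0⟩, hm⟩ (by rw [hX00]; exact ⟨hp, mem_ball_self hρ⟩)
      rw [sub_self, norm_zero, mul_zero, sub_zero, mem_sphere_zero_iff_norm.1 ht] at this
      exact absurd this (not_le.2 hτ)
  obtain ⟨δ, hδ, hδb⟩ := Metric.eventually_nhds_iff_ball.1 (hnhds.and hzero)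
  choose! T hT1 hT2 using fun s hs => (hδb s hs).2
  have hmem : ∀ s ∈ ball (0 : ℂ) δ, X s (T s) ∈ Z ∩ ball p ρ := fun s hs =>
    have h := (hδb s hs).1 _ (hT1 s hs)
    ⟨⟨(hb _ h).1, hT2 s hs⟩, h⟩
  -- `T` is only known to be Lipschitz, but this suffices because `f` has zero derivative at every
  -- point of the curve.
  have hder : ∀ s ∈ ball (0 : ℂ) δ, HasDerivAt (fun s => f (X s (T s))) 0 s := by
    intro s hs
    have h1 := hmem s hs
    have h2 : HasFDerivAt f (0 : E →L[ℂ] E) (X s (T s)) := by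
      have := (hf.differentiableAt (hU.mem_nhds h1.1.1)).hasFDerivAt
      rwa [hZ _ h1.1.1 h1.1.2] at this
    have hO : (fun s' => X s' (T s') - X s (T s)) =O[𝓝 s] fun s' => s' - s := by
      refine Asymptotics.IsBigO.of_bound (‖w‖ + C * ‖v‖) ?_
      filter_upwards [isOpen_ball.mem_nhds hs] with s' hs'
      have h3 : X s' (T s') - X s (T s) = (s' - s) • w + (T s' - T s) • v := by
        simp only [hX]; module
      rw [h3]
      refine (norm_add_le _ _).trans ?_
      rw [norm_smul, norm_smul]
      have := mul_le_mul_of_nonneg_right (hlip _ _ _ _ (hmem s' hs') h1) hvn.le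
      linarith
    have hcont : Tendsto (fun s' => X s' (T s')) (𝓝 s) (𝓝 (X s (T s))) := by
      have h3 : Tendsto (fun s' : ℂ => s' - s) (𝓝 s) (𝓝 0) := by
        have : Tendsto (fun s' : ℂ => s' - s) (𝓝 s) (𝓝 (s - s)) :=
          (by fun_prop : Continuous fun s' : ℂ => s' - s).tendsto s
        rwa [sub_self] at this
      exact tendsto_sub_nhds_zero_iff.1 (hO.trans_tendsto h3)
    rw [hasDerivAt_iff_isLittleO]
    have h4 := (hasFDerivAt_iff_isLittleO.1 h2).comp_tendsto hcont
    simpa [Function.comp_def] using h4.trans_isBigO hO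
  have hconst : ∀ s ∈ ball (0 : ℂ) δ, X s (T s) = X 0 (T 0) := by
    intro s hs
    have h0 : (0 : ℂ) ∈ ball (0 : ℂ) δ := mem_ball_self hδ
    have := (convex_ball (0 : ℂ) δ).norm_image_sub_le_of_norm_hasDerivWithin_le (C := 0)
      (fun x hx => (hder x hx).hasDerivWithinAt) (fun x hx => by simp) h0 hs
    rw [zero_mul] at this
    exact hinj (hmem s hs).1.1 (hmem 0 h0).1.1 (sub_eq_zero.1 (norm_le_zero_iff.1 this))
  have hs : ((δ / 2 : ℝ) : ℂ) ∈ ball (0 : ℂ) δ := by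
    rw [mem_ball_zero_iff, Complex.norm_real, Real.norm_of_nonneg (by positivity)]
    linarith
  have hfin := hconst _ hs
  set s : ℂ := ((δ / 2 : ℝ) : ℂ)
  have hs0 : s ≠ 0 := Complex.ofReal_ne_zero.2 (by positivity)
  refine hw (Submodule.mem_span_singleton.2 ⟨s⁻¹ * (T 0 - T s), ?_⟩)
  have h1 : s • w = (T 0 - T s) • v := by
    have h2 : p + s • w + T s • v = p + (0 : ℂ) • w + T 0 • v := hfin
    rw [zero_smul, add_zero, add_assoc, add_right_inj] at h2
    rw [sub_smul, ← h2, add_sub_cancel_right]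
  rw [mul_smul, ← h1, smul_smul, inv_mul_cancel₀ hs0, one_smul]

end Osgood

end

end GenSqueezing

/-! ### Osgood's theorem by induction on dimension -/

namespace GenSqueezing

section
open Metric Set

section Osgood

theorem det_fderiv_ne_zero_of_injOn_of_finrank_eq_one {E : Type*} [NormedAddCommGroup E]
    [NormedSpace ℂ E] [FiniteDimensional ℂ E]
    {U : Set E} (hU : IsOpen U) {f : E → E} (hf : DifferentiableOn ℂ f U) (hinj : InjOn f U)
    {x : E} (hx : x ∈ U) (hE : Module.finrank ℂ E = 1) : (fderiv ℂ f x).det ≠ 0 := by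
  let e : E ≃L[ℂ] ℂ := ContinuousLinearEquiv.ofFinrankEq (by simpa using hE)
  have hd : DifferentiableOn ℂ (e ∘ f ∘ e.symm) (e.symm ⁻¹' U) :=
    e.differentiable.comp_differentiableOn
      (hf.comp e.symm.differentiable.differentiableOn fun y hy => hy)
  have hne := deriv_ne_zero_of_injOn (hU.preimage e.symm.continuous) hd
    (e.injective.comp_injOn (hinj.comp e.symm.injective.injOn fun y hy => hy))
    (show e x ∈ e.symm ⁻¹' U by simpa using hx)
  have hfd : HasFDerivAt f (fderiv ℂ f x) (e.symm (e x)) := by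
    rw [e.symm_apply_apply]
    exact (hf.differentiableAt (hU.mem_nhds hx)).hasFDerivAt
  have hder : HasFDerivAt (e ∘ f ∘ e.symm)
      ((e : E →L[ℂ] ℂ).comp ((fderiv ℂ f x).comp (e.symm : ℂ →L[ℂ] E))) (e x) :=
    e.hasFDerivAt.comp _ (hfd.comp _ e.symm.hasFDerivAt)
  rw [hder.hasDerivAt.deriv] at hne
  intro h0
  obtain ⟨u, hu, hu0⟩ := Submodule.exists_mem_ne_zero_of_ne_bot
    (LinearMap.bot_lt_ker_of_det_eq_zero h0).ne'
  have hu' : fderiv ℂ f x u = 0 := hu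
  refine hne ?_
  have h1 : e.symm 1 = (e u)⁻¹ • u := by
    apply e.injective
    rw [e.apply_symm_apply, map_smul, smul_eq_mul, inv_mul_cancel₀]
    exact fun h => hu0 (e.injective (h.trans (map_zero e).symm))
  simp [h1, hu']

theorem exists_local_inverse {E E' : Type*} [NormedAddCommGroup E] [NormedSpace ℂ E]
    [FiniteDimensional ℂ E] [NormedAddCommGroup E'] [NormedSpace ℂ E'] [FiniteDimensional ℂ E']
    {U : Set E} (hU : IsOpen U) {G : E → E'} (hG : DifferentiableOn ℂ G U) {x : E} (hx : x ∈ U)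
    (hinj : Function.Injective (fderiv ℂ G x))
    (hdim : Module.finrank ℂ E = Module.finrank ℂ E') :
    ∃ (V : Set E') (ψ : E' → E), IsOpen V ∧ G x ∈ V ∧ DifferentiableOn ℂ ψ V ∧ MapsTo ψ V U ∧
      (∀ w ∈ V, G (ψ w) = w) ∧ ψ (G x) = x := by
  have : CompleteSpace E := FiniteDimensional.complete ℂ E
  let e : E ≃L[ℂ] E' := (LinearEquiv.ofInjectiveOfFinrankEq
    (fderiv ℂ G x : E →ₗ[ℂ] E') hinj hdim).toContinuousLinearEquiv
  have hGc : ContDiffAt ℂ 1 G x :=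
    (contDiffOn_one_of_differentiableOn hU hG).contDiffAt (hU.mem_nhds hx)
  have he : HasFDerivAt G (e : E →L[ℂ] E') x := by
    have h : (e : E →L[ℂ] E') = fderiv ℂ G x := by ext u; rfl
    rw [h]
    exact (hG.differentiableAt (hU.mem_nhds hx)).hasFDerivAt
  set ψ := hGc.localInverse he one_ne_zero
  have hψx : ψ (G x) = x := hGc.localInverse_apply_image he one_ne_zero
  have hψc : ContDiffAt ℂ 1 ψ (G x) := hGc.to_localInverse he one_ne_zero
  have h1 : ∀ᶠ w in 𝓝 (G x), ContDiffAt ℂ 1 ψ w := hψc.eventually (by simp)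
  have h2 : ∀ᶠ w in 𝓝 (G x), ψ w ∈ U :=
    hψc.continuousAt.eventually_mem (by rw [hψx]; exact hU.mem_nhds hx)
  have h3 : ∀ᶠ w in 𝓝 (G x), G (ψ w) = w :=
    (hGc.hasStrictFDerivAt' he one_ne_zero).eventually_right_inverse
  obtain ⟨V, hV, hVo, hxV⟩ := _root_.eventually_nhds_iff.1 (h1.and (h2.and h3))
  exact ⟨V, ψ, hVo, hxV,
    fun w hw => ((hV w hw).1.differentiableAt one_ne_zero).differentiableWithinAt,
    fun w hw => (hV w hw).2.1, fun w hw => (hV w hw).2.2, hψx⟩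

/-- The derivative of an injective holomorphic map between spaces of the same dimension is zero
as soon as it is singular, provided injective holomorphic maps in lower dimensions have
nonvanishing Jacobian. -/
theorem fderiv_eq_zero_of_det_eq_zero {E : Type} [NormedAddCommGroup E] [NormedSpace ℂ E]
    [FiniteDimensional ℂ E]
    (ih : ∀ (K : Type) [NormedAddCommGroup K] [NormedSpace ℂ K] [FiniteDimensional ℂ K],
      Module.finrank ℂ K < Module.finrank ℂ E → ∀ (U : Set K), IsOpen U → ∀ f : K → K,
        DifferentiableOn ℂ f U → InjOn f U → ∀ x ∈ U, (fderiv ℂ f x).det ≠ 0)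
    {U : Set E} (hU : IsOpen U) {f : E → E} (hf : DifferentiableOn ℂ f U) (hinj : InjOn f U)
    {x : E} (hx : x ∈ U) (hdet : (fderiv ℂ f x).det = 0) : fderiv ℂ f x = 0 := by
  by_contra hne
  set L : E →L[ℂ] E := fderiv ℂ f x with hL
  have hfx : HasFDerivAt f L x := (hf.differentiableAt (hU.mem_nhds hx)).hasFDerivAt
  set K : Submodule ℂ E := LinearMap.ker (L : E →ₗ[ℂ] E) with hK
  set R : Submodule ℂ E := LinearMap.range (L : E →ₗ[ℂ] E) with hR
  have hKbot : ⊥ < K := LinearMap.bot_lt_ker_of_det_eq_zero hdet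
  have hKtop : K ≠ ⊤ := by
    intro h
    exact hne (ContinuousLinearMap.coe_inj.1 (LinearMap.ker_eq_top.1 h))
  have hKlt : Module.finrank ℂ K < Module.finrank ℂ E := Submodule.finrank_lt hKtop
  obtain ⟨C, hC⟩ := Submodule.exists_isCompl R
  have hrn : Module.finrank ℂ R + Module.finrank ℂ K = Module.finrank ℂ E :=
    LinearMap.finrank_range_add_finrank_ker (L : E →ₗ[ℂ] E)
  have hrc := Submodule.finrank_add_eq_of_isCompl hC
  -- Rank-nullity matches a complement of the range with the kernel, so the `T` component of `f` on
  -- a slice becomes a self-map of `K`.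
  let θ : C ≃ₗ[ℂ] K := LinearEquiv.ofFinrankEq _ _ (by omega)
  let e : (R × C) ≃ₗ[ℂ] E := Submodule.prodEquivOfIsCompl R C hC
  let P : E →L[ℂ] R := LinearMap.toContinuousLinearMap (LinearMap.fst ℂ R C ∘ₗ e.symm.toLinearMap)
  let T : E →L[ℂ] K := LinearMap.toContinuousLinearMap
    (θ.toLinearMap ∘ₗ LinearMap.snd ℂ R C ∘ₗ e.symm.toLinearMap)
  have hPT : ∀ u u', P u = P u' → T u = T u' → u = u' := by
    intro u u' h1 h2
    exact e.symm.injective (Prod.ext h1 (θ.injective h2))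
  have hesymm : ∀ u, e.symm (L u) = ((⟨L u, u, rfl⟩ : R), (0 : C)) := by
    intro u
    rw [LinearEquiv.symm_apply_eq]
    simp [e]
  have hPL : ∀ u, P (L u) = (⟨L u, u, rfl⟩ : R) := fun u => congrArg Prod.fst (hesymm u)
  have hTL : ∀ u, T (L u) = 0 := fun u => by
    have : T (L u) = θ (e.symm (L u)).2 := rfl
    rw [this, hesymm, map_zero]
  obtain ⟨Q', hQ'⟩ := K.subtype.exists_leftInverse_of_injective K.ker_subtype
  let Q : E →L[ℂ] K := LinearMap.toContinuousLinearMap Q'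
  have hQ : ∀ k : K, Q k = k := fun k => LinearMap.congr_fun hQ' k
  -- These are local coordinates at `x`: `P` is faithful on the range of `L`, and `Q` on its kernel.
  have hG : DifferentiableOn ℂ (fun y => (P (f y), Q y)) U :=
    (P.differentiable.comp_differentiableOn hf).prodMk Q.differentiableOn
  have hGd : HasFDerivAt (fun y => (P (f y), Q y)) ((P.comp L).prod Q) x :=
    (P.hasFDerivAt.comp x hfx).prodMk Q.hasFDerivAt
  obtain ⟨V, ψ, hV, hxV, hψ, hψU, hGψ, hψx⟩ := exists_local_inverse hU hG hx (by
    rw [hGd.fderiv]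
    refine (injective_iff_map_eq_zero _).2 fun u hu => ?_
    have h1 : P (L u) = 0 := congrArg Prod.fst hu
    have h2 : Q u = 0 := congrArg Prod.snd hu
    rw [hPL] at h1
    have h3 : L u = 0 := congrArg Subtype.val h1
    have h4 := hQ ⟨u, h3⟩
    have h5 : (⟨u, h3⟩ : K) = 0 := h4.symm.trans h2
    exact congrArg Subtype.val h5) (by rw [Module.finrank_prod, ← hrn])
  set j : K → R × K := fun k => (P (f x), k) with hj
  have hjd : Differentiable ℂ j := by fun_prop
  have hW : IsOpen (j ⁻¹' V) := hV.preimage hjd.continuous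
  have hfirst : ∀ k ∈ j ⁻¹' V, P (f (ψ (j k))) = P (f x) := fun k hk =>
    (Prod.ext_iff.1 (hGψ (j k) hk)).1
  have hsecond : ∀ k ∈ j ⁻¹' V, Q (ψ (j k)) = k := fun k hk =>
    (Prod.ext_iff.1 (hGψ (j k) hk)).2
  have hψj : DifferentiableOn ℂ (fun k => ψ (j k)) (j ⁻¹' V) :=
    hψ.comp hjd.differentiableOn fun k hk => hk
  have hQx : Q x ∈ j ⁻¹' V := hxV
  -- On the slice `P ∘ f` is constant, so `T ∘ f` inherits injectivity. Yet its derivative at `Q x`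
  -- is zero, since `T` kills the range of `L`; as `K` is nontrivial, this contradicts the induction
  -- hypothesis.
  have hne' := ih K hKlt (j ⁻¹' V) hW (fun k => T (f (ψ (j k))))
    (T.differentiable.comp_differentiableOn (hf.comp hψj fun k hk => hψU hk))
    (fun k hk k' hk' h => by
      have h1 := hPT _ _ ((hfirst k hk).trans (hfirst k' hk').symm) h
      have h2 := hinj (hψU hk) (hψU hk') h1
      rw [← hsecond k hk, ← hsecond k' hk', h2]) (Q x) hQx
  have hjx : ψ (j (Q x)) = x := hψx
  have hψd := (hψj.differentiableAt (hW.mem_nhds hQx)).hasFDerivAt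
  have hfx' : HasFDerivAt f L (ψ (j (Q x))) := by rwa [hjx]
  have hcomp : HasFDerivAt (fun k => T (f (ψ (j k)))) (T.comp (L.comp _)) (Q x) :=
    T.hasFDerivAt.comp (Q x) (hfx'.comp (Q x) hψd)
  refine hne' ?_
  rw [hcomp.fderiv]
  obtain ⟨u, hu, hu0⟩ := Submodule.exists_mem_ne_zero_of_ne_bot hKbot.ne'
  refine LinearMap.det_eq_zero_iff_ker_ne_bot.2 fun h => hu0 ?_
  have : (⟨u, hu⟩ : K) ∈ (⊥ : Submodule ℂ K) := by
    rw [← h, LinearMap.mem_ker]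
    exact hTL _
  exact congrArg Subtype.val ((Submodule.mem_bot ℂ).1 this)

/-- **Osgood's theorem**: an injective holomorphic map between open subsets of `ℂⁿ` has
nonvanishing Jacobian determinant. -/
theorem det_fderiv_ne_zero_of_injOn (n : ℕ) : ∀ (E : Type) [NormedAddCommGroup E]
    [NormedSpace ℂ E] [FiniteDimensional ℂ E], Module.finrank ℂ E = n →
    ∀ (U : Set E), IsOpen U → ∀ f : E → E, DifferentiableOn ℂ f U → InjOn f U →
      ∀ x ∈ U, (fderiv ℂ f x).det ≠ 0 := by
  induction n using Nat.strong_induction_on with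
  | _ n ih =>
    intro E _ _ _ hE U hU f hf hinj x hx
    rcases Nat.lt_trichotomy n 1 with h0 | h1 | h2
    · have h : Module.finrank ℂ E = 0 := by omega
      rw [ContinuousLinearMap.det, LinearMap.det_eq_one_of_finrank_eq_zero h]
      exact one_ne_zero
    · exact det_fderiv_ne_zero_of_injOn_of_finrank_eq_one hU hf hinj hx (hE.trans h1)
    · refine det_fderiv_ne_zero_of_injOn_of_fderiv_eq_zero hU hf hinj ?_ (hE ▸ h2) x hx
      intro y hy hdet
      exact fderiv_eq_zero_of_det_eq_zero
        (fun K _ _ _ hK => ih _ (hE ▸ hK) K rfl) hU hf hinj hy hdet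

end Osgood

end

end GenSqueezing

namespace GenSqueezing

section
open Metric Set

/-! ### Limits of injective holomorphic maps -/

section Limits

theorem exists_limit_of_eventuallyHolBdd {E F : Type*} [NormedAddCommGroup E] [NormedSpace ℂ E]
    [FiniteDimensional ℂ E] [NormedAddCommGroup F] [NormedSpace ℂ F] [FiniteDimensional ℂ F]
    {ι : Type*} {𝓤 : Ultrafilter ι} {f : ι → E → F} {D : Set E} (hD : IsOpen D)
    (hf : ∀ x ∈ D, EventuallyHolBdd 𝓤 f x) :
    ∃ φ : E → F, DifferentiableOn ℂ φ D ∧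
      (∀ x ∈ D, Tendsto (fun q : ι × E => f q.1 q.2) (𝓤 ×ˢ 𝓝 x) (𝓝 (φ x))) ∧
      ∀ x ∈ D, Tendsto (fun q : ι × E => fderiv ℂ (f q.1) q.2) (𝓤 ×ˢ 𝓝 x)
        (𝓝 (fderiv ℂ φ x)) := by
  have : ProperSpace F := FiniteDimensional.proper ℂ _
  have hlim : ∀ x ∈ D, ∃ y, Tendsto (fun i => f i x) 𝓤 (𝓝 y) := by
    intro x hx
    obtain ⟨R, hR, M, h⟩ := hf x hx
    have hb : ∀ᶠ i in (𝓤 : Filter ι), f i x ∈ closedBall (0 : F) M := by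
      filter_upwards [h] with i hi
      simpa using hi.2 x (mem_ball_self hR)
    obtain ⟨y, -, hy⟩ := (isCompact_closedBall (0 : F) M).ultrafilter_le_nhds'
      (𝓤.map fun i => f i x) hb
    exact ⟨y, hy⟩
  choose! φ hφ using hlim
  have hd := fun x (hx : x ∈ D) => hasFDerivAt_of_ultrafilter_tendsto (φ := φ) (hf x hx)
    ((hD.eventually_mem hx).mono hφ)
  exact ⟨φ, fun x hx => (hd x hx).1.differentiableWithinAt,
    fun x hx => (hf x hx).tendsto_prod (hφ x hx),
    fun x hx => (hf x hx).fderiv.tendsto_prod (hd x hx).2⟩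

theorem det_fderiv_mul_det_fderiv_of_comp_eq_id {E : Type*} [NormedAddCommGroup E]
    [NormedSpace ℂ E] {f g : E → E} {w : E}
    (hf : DifferentiableAt ℂ f (g w)) (hg : DifferentiableAt ℂ g w)
    (h : ∀ᶠ y in 𝓝 w, f (g y) = y) :
    (fderiv ℂ f (g w)).det * (fderiv ℂ g w).det = 1 := by
  have h1 : HasFDerivAt (f ∘ g) ((fderiv ℂ f (g w)).comp (fderiv ℂ g w)) w :=
    hf.hasFDerivAt.comp w hg.hasFDerivAt
  have h2 : HasFDerivAt (f ∘ g) (ContinuousLinearMap.id ℂ E) w :=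
    (hasFDerivAt_id w).congr_of_eventuallyEq h
  have h3 := congrArg ContinuousLinearMap.det (h1.unique h2)
  rw [ContinuousLinearMap.det, ContinuousLinearMap.toLinearMap_comp, LinearMap.det_comp] at h3
  rw [ContinuousLinearMap.det, ContinuousLinearMap.det, h3]
  simp [ContinuousLinearMap.det]

variable {E : Type} [NormedAddCommGroup E] [NormedSpace ℂ E] [FiniteDimensional ℂ E]

/-- Maps converging in the `C¹` sense at a point where the limit derivative is invertible
eventually cover a fixed neighbourhood of the limit value. -/
theorem exists_nhds_eventually_subset_image {ι : Type*} {𝓕 : Filter ι} {f : ι → E → E} {x z : E}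
    {A : E →L[ℂ] E} (hA : A.det ≠ 0)
    (hhol : ∃ R > 0, ∀ᶠ i in 𝓕, DifferentiableOn ℂ (f i) (ball x R))
    (hx : Tendsto (fun i => f i x) 𝓕 (𝓝 z))
    (hd : Tendsto (fun q : ι × E => fderiv ℂ (f q.1) q.2) (𝓕 ×ˢ 𝓝 x) (𝓝 A))
    {W : Set E} (hW : W ∈ 𝓝 x) : ∃ V ∈ 𝓝 z, ∀ᶠ i in 𝓕, V ⊆ f i '' W := by
  have : CompleteSpace E := FiniteDimensional.complete ℂ E
  obtain ⟨R, hR, hhol⟩ := hhol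
  let e : E ≃L[ℂ] E := A.toContinuousLinearEquivOfDetNeZero hA
  have heA : ∀ u, A (e.symm u) = u := fun u => e.apply_symm_apply u
  let N : NNReal := ‖(e.symm : E →L[ℂ] E)‖₊ + 1
  have hN : 0 < N := by positivity
  let S : A.NonlinearRightInverse :=
    { toFun := e.symm
      nnnorm := N
      bound' := fun y => by
        refine ((e.symm : E →L[ℂ] E).le_opNorm y).trans ?_
        gcongr
        simp [N]
      right_inv' := heA }
  set c : NNReal := N⁻¹ / 2
  have hc : 0 < c := by positivity
  obtain ⟨P, hP, Q, hQ, hPQ⟩ := eventually_prod_iff.1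
    (hd.eventually (closedBall_mem_nhds A (NNReal.coe_pos.2 hc)))
  obtain ⟨ε₁, hε₁, hball⟩ := Metric.mem_nhds_iff.1 (inter_mem hW (inter_mem hQ (ball_mem_nhds x hR)))
  set ε := ε₁ / 2
  have hε : 0 < ε := half_pos hε₁
  have hsub : closedBall x ε ⊆ ball x ε₁ := closedBall_subset_ball (half_lt_self hε₁)
  -- The image of the `ε`-ball contains the `η`-ball about `f i x`; half of `η` is spent on the
  -- distance from `f i x` to `z`.
  set η : ℝ := (((S.nnnorm : ℝ))⁻¹ - c) * ε with hη
  have hη0 : 0 < η := by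
    refine mul_pos ?_ hε
    have : ((S.nnnorm : ℝ))⁻¹ = (N : ℝ)⁻¹ := rfl
    rw [this]
    simp only [c, NNReal.coe_div, NNReal.coe_inv, NNReal.coe_ofNat]
    have : 0 < (N : ℝ)⁻¹ := by positivity
    linarith
  refine ⟨ball z (η / 2), ball_mem_nhds z (half_pos hη0), ?_⟩
  filter_upwards [hhol, hP, hx.eventually (ball_mem_nhds z (half_pos hη0))] with i hi hPi hxi
  have happ : ApproximatesLinearOn (f i) A (closedBall x ε) c := by
    intro y hy w hw
    refine (convex_closedBall x ε).norm_image_sub_le_of_norm_hasFDerivWithin_le'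
      (f' := fun u => fderiv ℂ (f i) u) (fun u hu => ?_) (fun u hu => ?_) hw hy
    · exact ((hi.differentiableAt (isOpen_ball.mem_nhds
        (hball (hsub hu)).2.2)).hasFDerivAt).hasFDerivWithinAt
    · have := hPQ hPi (hball (hsub hu)).2.1
      rwa [dist_eq_norm] at this
  have hsurj := happ.surjOn_closedBall_of_nonlinearRightInverse S hε.le Subset.rfl
  intro y hy
  have hy' : y ∈ closedBall (f i x) η := by
    rw [mem_closedBall]
    rw [mem_ball] at hy
    rw [dist_comm] at hxi
    linarith [dist_triangle y z (f i x)]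
  obtain ⟨u, hu, rfl⟩ := hsurj hy'
  exact ⟨u, (hball (hsub hu)).1, rfl⟩

/-- Osgood's theorem supplies holomorphic local inverses, and injectivity makes them agree with the
global one. -/
theorem differentiableOn_invFunOn {U W : Set E} (hU : IsOpen U) {f : E → E}
    (hf : DifferentiableOn ℂ f U) (hinj : InjOn f U) (hWf : W ⊆ f '' U) :
    DifferentiableOn ℂ (Function.invFunOn f U) W := by
  intro w hw
  obtain ⟨x, hx, rfl⟩ := hWf hw
  have hdet := det_fderiv_ne_zero_of_injOn _ E rfl U hU f hf hinj x hx
  obtain ⟨V, ψ, hV, hxV, hψ, hψU, hfψ, -⟩ := exists_local_inverse hU hf hx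
    ((fderiv ℂ f x).toContinuousLinearEquivOfDetNeZero hdet).injective rfl
  refine ((hψ.differentiableAt (hV.mem_nhds hxV)).congr_of_eventuallyEq
    ?_).differentiableWithinAt
  filter_upwards [hV.mem_nhds hxV] with y hy
  conv_lhs => rw [← hfψ y hy]
  exact hinj.leftInvOn_invFunOn (hψU hy)

/-- A limit of injective holomorphic maps on domains exhausting `D`, all of whose images lie in a
bounded convex set `Ω` and contain a fixed connected open set `W ∋ 0`, is again such a map. -/
theorem exists_injHol_limit {ι : Type*} {𝓤 : Ultrafilter ι} {D Ω W : Set E} {S : ι → Set E}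
    {f : ι → E → E} {ζ : ι → E} {z : E} (hD : IsOpen D) (hDc : IsPreconnected D)
    (hDb : Bornology.IsBounded D) (hΩ : IsOpen Ω) (hΩb : Bornology.IsBounded Ω)
    (hΩc : Convex ℝ Ω) (hW : IsOpen W) (hWc : IsPreconnected W) (h0W : 0 ∈ W)
    (hSo : ∀ i, IsOpen (S i)) (hSD : ∀ i, S i ⊆ D)
    (hS : ∀ K ⊆ D, IsCompact K → ∀ᶠ i in (𝓤 : Filter ι), K ⊆ S i)
    (hz : z ∈ D) (hζ : Tendsto ζ 𝓤 (𝓝 z))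
    (hf : ∀ᶠ i in (𝓤 : Filter ι), ζ i ∈ S i ∧ DifferentiableOn ℂ (f i) (S i) ∧ InjOn (f i) (S i) ∧
      MapsTo (f i) (S i) Ω ∧ f i (ζ i) = 0 ∧ W ⊆ f i '' S i) :
    ∃ φ : E → E, DifferentiableOn ℂ φ D ∧ InjOn φ D ∧ MapsTo φ D Ω ∧ φ z = 0 ∧ W ⊆ φ '' D := by
  have : ProperSpace E := FiniteDimensional.proper ℂ _
  obtain ⟨M, hM⟩ := hΩb.exists_norm_le
  obtain ⟨M', hM'⟩ := hDb.exists_norm_le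
  set g : ι → E → E := fun i => Function.invFunOn (f i) (S i) with hg
  have hgmem : ∀ᶠ i in (𝓤 : Filter ι), ∀ w ∈ W, g i w ∈ S i ∧ f i (g i w) = w := by
    filter_upwards [hf] with i hi w hw
    exact ⟨Function.invFunOn_mem (hi.2.2.2.2.2 hw), Function.invFunOn_eq (hi.2.2.2.2.2 hw)⟩
  have hgdiff : ∀ᶠ i in (𝓤 : Filter ι), DifferentiableOn ℂ (g i) W := by
    filter_upwards [hf] with i hi
    exact differentiableOn_invFunOn (hSo i) hi.2.1 hi.2.2.1 hi.2.2.2.2.2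
  have hg0 : ∀ᶠ i in (𝓤 : Filter ι), g i 0 = ζ i := by
    filter_upwards [hf] with i hi
    rw [← hi.2.2.2.2.1]
    exact hi.2.2.1.leftInvOn_invFunOn hi.1
  have hball : ∀ x ∈ D, ∃ R > 0, ∀ᶠ i in (𝓤 : Filter ι), ball x R ⊆ S i := by
    intro x hx
    obtain ⟨R, hR, hRD⟩ := Metric.nhds_basis_closedBall.mem_iff.1 (hD.mem_nhds hx)
    exact ⟨R, hR, (hS _ hRD (isCompact_closedBall x R)).mono fun i hi =>
      ball_subset_closedBall.trans hi⟩
  have hfE : ∀ x ∈ D, EventuallyHolBdd (𝓤 : Filter ι) f x := by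
    intro x hx
    obtain ⟨R, hR, h⟩ := hball x hx
    refine ⟨R, hR, M, ?_⟩
    filter_upwards [h, hf] with i hi hfi
    exact ⟨hfi.2.1.mono hi, fun y hy => hM _ (hfi.2.2.2.1 (hi hy))⟩
  have hgE : ∀ w ∈ W, EventuallyHolBdd (𝓤 : Filter ι) g w := by
    intro w hw
    obtain ⟨R, hR, hRW⟩ := Metric.isOpen_iff.1 hW w hw
    refine ⟨R, hR, M', ?_⟩
    filter_upwards [hgdiff, hgmem] with i hi hgi
    exact ⟨hi.mono hRW, fun y hy => hM' _ (hSD i (hgi y (hRW hy)).1)⟩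
  obtain ⟨φ, hφd, hφ, hφ'⟩ := exists_limit_of_eventuallyHolBdd hD hfE
  obtain ⟨γ, hγd, hγ, hγ'⟩ := exists_limit_of_eventuallyHolBdd hW hgE
  have hcomp : ∀ {F : Type} {_ : TopologicalSpace F} {h : ι → E → F} {x : E} {y : F} {ξ : ι → E},
      Tendsto (fun q : ι × E => h q.1 q.2) (𝓤 ×ˢ 𝓝 x) (𝓝 y) → Tendsto ξ 𝓤 (𝓝 x) →
      Tendsto (fun i => h i (ξ i)) 𝓤 (𝓝 y) := fun h1 h2 => h1.comp (tendsto_id.prodMk h2)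
  have hφz : φ z = 0 := by
    refine tendsto_nhds_unique (hcomp (hφ z hz) hζ) (tendsto_const_nhds.congr' ?_)
    filter_upwards [hf] with i hi
    exact hi.2.2.2.2.1.symm
  have hdetfg : ∀ᶠ i in (𝓤 : Filter ι), ∀ w ∈ W,
      (fderiv ℂ (f i) (g i w)).det * (fderiv ℂ (g i) w).det = 1 := by
    filter_upwards [hf, hgmem, hgdiff] with i hi hgi hgd w hw
    exact det_fderiv_mul_det_fderiv_of_comp_eq_id
      (hi.2.1.differentiableAt ((hSo i).mem_nhds (hgi w hw).1))
      (hgd.differentiableAt (hW.mem_nhds hw))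
      ((hW.eventually_mem hw).mono fun y hy => (hgi y hy).2)
  -- This rules out the degenerate alternative in Hurwitz's theorem for both Jacobians.
  have hdet0 : (fderiv ℂ φ z).det * (fderiv ℂ γ 0).det = 1 := by
    have h1 : Tendsto (fun i => (fderiv ℂ (f i) (ζ i)).det * (fderiv ℂ (g i) 0).det) 𝓤
        (𝓝 ((fderiv ℂ φ z).det * (fderiv ℂ γ 0).det)) :=
      ((ContinuousLinearMap.continuous_det.tendsto _).comp (hcomp (hφ' z hz) hζ)).mul
        ((ContinuousLinearMap.continuous_det.tendsto _).comp
          (hcomp (hγ' 0 h0W) tendsto_const_nhds))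
    refine tendsto_nhds_unique h1 (tendsto_const_nhds.congr' ?_)
    filter_upwards [hdetfg, hg0] with i hi hi0
    rw [← hi0, hi 0 h0W]
  have hdetf : ∀ x ∈ D, (fderiv ℂ φ x).det ≠ 0 := by
    refine ne_zero_of_tendsto_of_ne_zero (𝓕 := (𝓤 : Filter ι))
      (h := fun i x => (fderiv ℂ (f i) x).det) hD hDc ?_ ?_ ?_
      ⟨z, hz, left_ne_zero_of_mul_eq_one hdet0⟩
    · exact Differentiable.comp_differentiableOn (g := fun A : E →L[ℂ] E => A.det)
        differentiable_det (differentiableOn_fderiv hD hφd)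
    · intro x hx
      obtain ⟨R, hR, h⟩ := hball x hx
      refine ⟨R, hR, ?_⟩
      filter_upwards [h, hf] with i hi hfi
      exact ⟨Differentiable.comp_differentiableOn (g := fun A : E →L[ℂ] E => A.det)
        differentiable_det ((differentiableOn_fderiv (hSo i) hfi.2.1).mono hi), fun y hy =>
        det_fderiv_ne_zero_of_injOn _ E rfl (S i) (hSo i) (f i) hfi.2.1 hfi.2.2.1 y (hi hy)⟩
    · exact fun x hx => (ContinuousLinearMap.continuous_det.tendsto _).comp (hφ' x hx)
  have hdetg : ∀ w ∈ W, (fderiv ℂ γ w).det ≠ 0 := by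
    refine ne_zero_of_tendsto_of_ne_zero (𝓕 := (𝓤 : Filter ι))
      (h := fun i x => (fderiv ℂ (g i) x).det) hW hWc ?_ ?_ ?_
      ⟨0, h0W, right_ne_zero_of_mul_eq_one hdet0⟩
    · exact Differentiable.comp_differentiableOn (g := fun A : E →L[ℂ] E => A.det)
        differentiable_det (differentiableOn_fderiv hW hγd)
    · intro w hw
      obtain ⟨R, hR, hRW⟩ := Metric.isOpen_iff.1 hW w hw
      refine ⟨R, hR, ?_⟩
      filter_upwards [hgdiff, hdetfg] with i hi hfi
      exact ⟨Differentiable.comp_differentiableOn (g := fun A : E →L[ℂ] E => A.det)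
        differentiable_det ((differentiableOn_fderiv hW hi).mono hRW), fun y hy =>
        right_ne_zero_of_mul_eq_one (hfi y (hRW hy))⟩
    · exact fun w hw => (ContinuousLinearMap.continuous_det.tendsto _).comp (hγ' w hw)
  have hcover : ∀ x ∈ D, ∀ N ∈ 𝓝 x, ∃ V ∈ 𝓝 (φ x), ∀ᶠ i in (𝓤 : Filter ι), V ⊆ f i '' N := by
    intro x hx N hN
    obtain ⟨R, hR, M, h⟩ := hfE x hx
    exact exists_nhds_eventually_subset_image (hdetf x hx) ⟨R, hR, h.mono fun i hi => hi.1⟩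
      (hcomp (hφ x hx) tendsto_const_nhds) (hφ' x hx) hN
  -- A limit of points of `D` might lie on its boundary; here a whole neighbourhood of `γ w` is
  -- covered by some `g i '' W ⊆ D`.
  have hγD : ∀ w ∈ W, γ w ∈ D := by
    intro w hw
    obtain ⟨R, hR, M, h⟩ := hgE w hw
    obtain ⟨V, hV, hVi⟩ := exists_nhds_eventually_subset_image (hdetg w hw)
      ⟨R, hR, h.mono fun i hi => hi.1⟩ (hcomp (hγ w hw) tendsto_const_nhds) (hγ' w hw)
      (hW.mem_nhds hw)
    obtain ⟨i, hi, hgi⟩ := (hVi.and hgmem).exists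
    obtain ⟨y, hy, hy'⟩ := hi (mem_of_mem_nhds hV)
    rw [← hy']
    exact hSD i (hgi y hy).1
  refine ⟨φ, hφd, ?_, ?_, hφz, ?_⟩
  -- Disjoint neighbourhoods of `a` and `b` would both have the common value `φ a` in their images
  -- under one injective `f i`.
  · intro a ha b hb hab
    by_contra hne
    obtain ⟨A, B, hA, hB, haA, hbB, hAB⟩ := t2_separation hne
    obtain ⟨RA, hRA, hSA⟩ := hball a ha
    obtain ⟨RB, hRB, hSB⟩ := hball b hb
    obtain ⟨VA, hVA, hA'⟩ := hcover a ha _ (inter_mem (hA.mem_nhds haA) (ball_mem_nhds a hRA))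
    obtain ⟨VB, hVB, hB'⟩ := hcover b hb _ (inter_mem (hB.mem_nhds hbB) (ball_mem_nhds b hRB))
    obtain ⟨i, hiA, hiB, hiSA, hiSB, hi⟩ :=
      (hA'.and (hB'.and (hSA.and (hSB.and hf)))).exists
    obtain ⟨a', ha', haa⟩ := hiA (mem_of_mem_nhds hVA)
    obtain ⟨b', hb', hbb⟩ := hiB (mem_of_mem_nhds hVB)
    have hab' : a' = b' := hi.2.2.1 (hiSA ha'.2) (hiSB hb'.2) (by rw [haa, hbb, hab])
    exact hAB.ne_of_mem ha'.1 hb'.1 hab'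
  · intro x hx
    have h1 : φ x ∈ interior (closure Ω) := by
      rw [mem_interior_iff_mem_nhds]
      obtain ⟨R, hR, hRS⟩ := hball x hx
      obtain ⟨V, hV, hVi⟩ := hcover x hx _ (ball_mem_nhds x hR)
      obtain ⟨i, hi, hi', hi''⟩ := (hVi.and (hRS.and hf)).exists
      refine mem_of_superset hV (hi.trans ?_)
      exact (image_subset_iff.2 fun y hy => hi''.2.2.2.1 (hi' hy)).trans subset_closure
    obtain ⟨i, hi⟩ := hf.exists
    rwa [hΩc.interior_closure_eq_interior_of_nonempty_interior
      (by rw [hΩ.interior_eq]; exact ⟨_, hi.2.2.2.1 hi.1⟩), hΩ.interior_eq] at h1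
  · intro w hw
    refine ⟨γ w, hγD w hw, ?_⟩
    refine tendsto_nhds_unique (hcomp (hφ _ (hγD w hw)) (hcomp (hγ w hw) tendsto_const_nhds))
      (tendsto_const_nhds.congr' ?_)
    filter_upwards [hgmem] with i hi
    exact (hi w hw).2.symm

end Limits

end

end GenSqueezing

namespace GenSqueezing

section
open Metric Set

/-! ### Semicontinuity and joint convergence of squeezing functions -/

section Squeezing

variable {n : ℕ} {Ω : Set (Cn n)}

theorem gauge_lt_one_iff_mem (hΩ : IsOpen Ω) (hΩc : Convex ℝ Ω) (h0 : 0 ∈ Ω) (x : Cn n) :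
    gauge Ω x < 1 ↔ x ∈ Ω :=
  ⟨fun h => setOfPred_gauge_lt_one_subset_self hΩc h0 (absorbent_nhds_zero (hΩ.mem_nhds h0)) h,
    fun h => gauge_lt_one_of_mem_of_isOpen hΩ h⟩

theorem isOpen_sublevel (hΩ : IsOpen Ω) (hΩc : Convex ℝ Ω) (h0 : 0 ∈ Ω) (r : ℝ) :
    IsOpen (sublevel Ω r) :=
  isOpen_lt (continuous_gauge hΩc (hΩ.mem_nhds h0)) continuous_const

theorem convex_sublevel (hΩ : IsOpen Ω) (hΩc : Convex ℝ Ω) (h0 : 0 ∈ Ω) (r : ℝ) :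
    Convex ℝ (sublevel Ω r) := by
  intro x hx y hy a b ha hb hab
  have h := gauge_add_le hΩc (absorbent_nhds_zero (hΩ.mem_nhds h0)) (a • x) (b • y)
  rw [gauge_smul_of_nonneg ha, gauge_smul_of_nonneg hb] at h
  exact lt_of_le_of_lt h (convex_Iio r hx hy ha hb hab)

theorem sublevel_mono {r s : ℝ} (h : r ≤ s) : sublevel Ω r ⊆ sublevel Ω s :=
  fun _ hx => lt_of_lt_of_le hx h

theorem isCompact_gauge_le (hΩ : IsOpen Ω) (hΩb : Bornology.IsBounded Ω) (hΩc : Convex ℝ Ω)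
    (h0 : 0 ∈ Ω) {c : ℝ} (hc : c < 1) : IsCompact {x : Cn n | gauge Ω x ≤ c} :=
  Metric.isCompact_of_isClosed_isBounded
    (isClosed_le (continuous_gauge hΩc (hΩ.mem_nhds h0)) continuous_const)
    (hΩb.subset fun x hx => (gauge_lt_one_iff_mem hΩ hΩc h0 x).1 (lt_of_le_of_lt hx hc))

/-- The set of radii whose supremum is the generalized squeezing function. -/
def squeezingRadii (Ω D : Set (Cn n)) (z : Cn n) : Set ℝ :=
  {r : ℝ | 0 < r ∧ r < 1 ∧
    ∃ f : Cn n → Cn n, IsInjHol D Ω f ∧ f z = 0 ∧ sublevel Ω r ⊆ f '' D}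

theorem squeezing_nonneg (Ω D : Set (Cn n)) (z : Cn n) : 0 ≤ squeezing Ω D z :=
  Real.sSup_nonneg fun _ hr => hr.1.le

theorem le_squeezing {D : Set (Cn n)} {z : Cn n} {r : ℝ} (hr : r ∈ squeezingRadii Ω D z) :
    r ≤ squeezing Ω D z :=
  le_csSup ⟨1, fun _ hs => hs.2.1.le⟩ hr

theorem exists_lt_mem_squeezingRadii {D : Set (Cn n)} {z : Cn n} {a : ℝ} (ha : 0 ≤ a)
    (h : a < squeezing Ω D z) : ∃ r ∈ squeezingRadii Ω D z, a < r := by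
  -- The supremum of the empty set is `0`, so `0 ≤ a` excludes that case.
  rcases (squeezingRadii Ω D z).eq_empty_or_nonempty with he | hne
  · have : squeezing Ω D z = sSup (squeezingRadii Ω D z) := rfl
    rw [this, he, Real.sSup_empty] at h
    exact absurd h (not_lt.2 ha)
  · exact exists_lt_of_lt_csSup hne h

/-- Recentring an admissible map at nearby points and restricting it to exhausting subdomains
loses arbitrarily little of the radius. -/
theorem eventually_mem_squeezingRadii {ι : Type*} {𝓕 : Filter ι} {D : Set (Cn n)}
    {S : ι → Set (Cn n)} (hΩ : IsOpen Ω) (hΩb : Bornology.IsBounded Ω) (hΩc : Convex ℝ Ω)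
    (hΩbal : Balanced ℂ Ω) (h0 : 0 ∈ Ω) (hD : IsOpen D) (hSD : ∀ i, S i ⊆ D)
    (hS : ∀ K ⊆ D, IsCompact K → ∀ᶠ i in 𝓕, K ⊆ S i) {z : Cn n} (hz : z ∈ D) {r r' : ℝ}
    (hr : r ∈ squeezingRadii Ω D z) (hr' : 0 < r') (hrr : r' < r) :
    ∀ᶠ q : ι × Cn n in 𝓕 ×ˢ 𝓝 z, r' ∈ squeezingRadii Ω (S q.1) q.2 := by
  obtain ⟨hr0, hr1, φ, ⟨hφd, hφi, hφm⟩, hφz, hφs⟩ := hr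
  have habs : Absorbent ℝ Ω := absorbent_nhds_zero (hΩ.mem_nhds h0)
  have hgc : Continuous (gauge Ω) := continuous_gauge hΩc (hΩ.mem_nhds h0)
  -- Room on both sides: `c < r` makes the preimage of the `c`-sublevel set compact in `D`, and `r'
  -- < c` absorbs the shift by `φ y` and the factor `1 + δ`.
  set c := (r' + r) / 2 with hc
  have hK : IsCompact (Function.invFunOn φ D '' {x | gauge Ω x ≤ c}) := by
    refine (isCompact_gauge_le hΩ hΩb hΩc h0 (by linarith)).image_of_continuousOn ?_
    refine ((differentiableOn_invFunOn hD hφd hφi hφs).continuousOn).mono fun x hx => ?_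
    exact lt_of_le_of_lt hx (by linarith : c < r)
  have hmem : ∀ x, gauge Ω x ≤ c → x ∈ φ '' D := fun x hx =>
    hφs (lt_of_le_of_lt hx (by linarith : c < r))
  have hKD : Function.invFunOn φ D '' {x | gauge Ω x ≤ c} ⊆ D := by
    rintro _ ⟨x, hx, rfl⟩
    exact Function.invFunOn_mem (hmem x hx)
  have hnear : ∀ᶠ y in 𝓝 z, (1 + gauge Ω (φ y)) * r' + gauge Ω (φ y) < c := by
    have h1 : ContinuousAt (fun y => gauge Ω (φ y)) z :=
      hgc.continuousAt.comp (hφd.differentiableAt (hD.mem_nhds hz)).continuousAt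
    have h2 : ContinuousAt (fun y => (1 + gauge Ω (φ y)) * r' + gauge Ω (φ y)) z :=
      ((continuousAt_const.add h1).mul continuousAt_const).add h1
    refine h2.eventually_lt continuousAt_const ?_
    rw [hφz, gauge_zero]
    linarith
  filter_upwards [(hS _ hKD hK).prod_mk hnear] with q hq
  obtain ⟨hqK, hqy⟩ := hq
  set y := q.2
  set δ := gauge Ω (φ y)
  have hδ : 0 ≤ δ := gauge_nonneg _
  have hδ1 : 0 < 1 + δ := by linarith
  -- Balancedness makes the gauge even, so `φ x - φ y` has gauge below `1 + δ`, which explains the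
  -- rescaling factor.
  have hneg : gauge Ω (-φ y) = δ :=
    gauge_neg (fun x hx => hΩbal.neg_mem_iff.2 hx) _
  refine ⟨hr', by linarith, fun x => (1 + δ)⁻¹ • (φ x - φ y), ⟨?_, ?_, ?_⟩, by simp, ?_⟩
  · exact ((hφd.mono (hSD _)).sub_const (φ y)).const_smul ((1 + δ)⁻¹ : ℝ)
  · intro x hx x' hx' h
    have h1 := smul_right_injective (Cn n) (inv_ne_zero hδ1.ne') h
    exact hφi (hSD _ hx) (hSD _ hx') (sub_left_injective h1)
  · intro x hx
    rw [← gauge_lt_one_iff_mem hΩ hΩc h0, gauge_smul_of_nonneg (by positivity), smul_eq_mul,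
      inv_mul_lt_iff₀ hδ1, mul_one, sub_eq_add_neg]
    have h1 := (gauge_lt_one_iff_mem hΩ hΩc h0 _).2 (hφm (hSD _ hx))
    linarith [gauge_add_le hΩc habs (φ x) (-φ y)]
  · intro w hw
    have hw : gauge Ω w < r' := hw
    have h1 : gauge Ω ((1 + δ) • w + φ y) ≤ c := by
      have h2 := gauge_add_le hΩc habs ((1 + δ) • w) (φ y)
      rw [gauge_smul_of_nonneg hδ1.le, smul_eq_mul] at h2
      have h3 := mul_lt_mul_of_pos_left hw hδ1
      linarith
    refine ⟨Function.invFunOn φ D ((1 + δ) • w + φ y), hqK (mem_image_of_mem _ h1), ?_⟩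
    simp only [Function.invFunOn_eq (hmem _ h1), add_sub_cancel_right, smul_smul,
      inv_mul_cancel₀ hδ1.ne', one_smul]

/-- Joint convergence of the generalized squeezing functions of exhausting subdomains. -/
theorem tendsto_squeezing {ι : Type*} {𝓕 : Filter ι} {D : Set (Cn n)}
    {S : ι → Set (Cn n)} (hΩ : IsOpen Ω) (hΩb : Bornology.IsBounded Ω) (hΩc : Convex ℝ Ω)
    (hΩbal : Balanced ℂ Ω) (h0 : 0 ∈ Ω) (hD : IsOpen D) (hDc : IsPreconnected D)
    (hDb : Bornology.IsBounded D) (hSo : ∀ i, IsOpen (S i)) (hSD : ∀ i, S i ⊆ D)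
    (hS : ∀ K ⊆ D, IsCompact K → ∀ᶠ i in 𝓕, K ⊆ S i) {z : Cn n} (hz : z ∈ D) :
    Tendsto (fun q : ι × Cn n => squeezing Ω (S q.1) q.2) (𝓕 ×ˢ 𝓝 z)
      (𝓝 (squeezing Ω D z)) := by
  refine tendsto_order.2 ⟨fun a ha => ?_, fun a ha => ?_⟩
  · rcases lt_or_ge a 0 with ha0 | ha0
    · exact Eventually.of_forall fun q => ha0.trans_le (squeezing_nonneg _ _ _)
    · obtain ⟨r, hr, har⟩ := exists_lt_mem_squeezingRadii ha0 ha
      filter_upwards [eventually_mem_squeezingRadii hΩ hΩb hΩc hΩbal h0 hD hSD hS hz hr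
        (r' := (a + r) / 2) (by linarith) (by linarith)] with q hq
      exact lt_of_lt_of_le (by linarith) (le_squeezing hq)
  · by_contra hnot
    obtain ⟨b, hb, hba⟩ := exists_between ha
    have hb0 : 0 < b := (squeezing_nonneg _ _ _).trans_lt hb
    have hfreq : ∃ᶠ q : ι × Cn n in 𝓕 ×ˢ 𝓝 z, b < squeezing Ω (S q.1) q.2 := by
      refine (not_eventually.1 hnot).mono fun q hq => hba.trans_le (not_lt.1 hq)
    have : NeBot ((𝓕 ×ˢ 𝓝 z) ⊓ 𝓟 {q : ι × Cn n | b < squeezing Ω (S q.1) q.2}) :=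
      inf_principal_neBot_iff.2 fun U hU => (hfreq.and_eventually hU).exists.imp
        fun q hq => ⟨hq.2, hq.1⟩
    -- The ultrafilter lives on pairs of index and centre, so the moving centres converge to `z`
    -- along it while every squeezing value considered exceeds `b`.
    let 𝓤 : Ultrafilter (ι × Cn n) :=
      Ultrafilter.of ((𝓕 ×ˢ 𝓝 z) ⊓ 𝓟 {q : ι × Cn n | b < squeezing Ω (S q.1) q.2})
    have h𝓤 := Ultrafilter.of_le
      ((𝓕 ×ˢ 𝓝 z) ⊓ 𝓟 {q : ι × Cn n | b < squeezing Ω (S q.1) q.2})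
    have h𝓤₁ : (𝓤 : Filter (ι × Cn n)) ≤ 𝓕 ×ˢ 𝓝 z := h𝓤.trans inf_le_left
    have h𝓤₂ : ∀ᶠ q in (𝓤 : Filter (ι × Cn n)), b < squeezing Ω (S q.1) q.2 :=
      h𝓤 (mem_inf_of_right (mem_principal_self _))
    have hS' : ∀ K ⊆ D, IsCompact K → ∀ᶠ q in (𝓤 : Filter (ι × Cn n)), K ⊆ S q.1 :=
      fun K hK hKc => h𝓤₁ (tendsto_fst.eventually (hS K hK hKc))
    have hζ : Tendsto Prod.snd (𝓤 : Filter (ι × Cn n)) (𝓝 z) := tendsto_snd.mono_left h𝓤₁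
    have hchoice : ∀ q : ι × Cn n, ∃ f : Cn n → Cn n, b < squeezing Ω (S q.1) q.2 →
        b < 1 ∧ IsInjHol (S q.1) Ω f ∧ f q.2 = 0 ∧ sublevel Ω b ⊆ f '' S q.1 := by
      intro q
      by_cases hq : b < squeezing Ω (S q.1) q.2
      · obtain ⟨r, ⟨-, hr1, f, hf, hf0, hfr⟩, hbr⟩ := exists_lt_mem_squeezingRadii hb0.le hq
        exact ⟨f, fun _ => ⟨hbr.trans hr1, hf, hf0, (sublevel_mono hbr.le).trans hfr⟩⟩
      · exact ⟨0, fun h => absurd h hq⟩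
    choose f hf using hchoice
    obtain ⟨R, hR, hRD⟩ := Metric.nhds_basis_closedBall.mem_iff.1 (hD.mem_nhds hz)
    obtain ⟨φ, hφd, hφi, hφm, hφz, hφs⟩ := exists_injHol_limit (𝓤 := 𝓤) (S := fun q => S q.1)
      (f := f) (ζ := Prod.snd) hD hDc hDb hΩ hΩb hΩc (isOpen_sublevel hΩ hΩc h0 b)
      (convex_sublevel hΩ hΩc h0 b).isPreconnected
      (show gauge Ω 0 < b by rwa [gauge_zero]) (fun q => hSo q.1) (fun q => hSD q.1) hS' hz hζ (by
        filter_upwards [h𝓤₂, hS' _ hRD (isCompact_closedBall z R),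
          hζ.eventually (closedBall_mem_nhds z hR)] with q hq hqS hqz
        obtain ⟨-, ⟨h1, h2, h3⟩, h4, h5⟩ := hf q hq
        exact ⟨hqS hqz, h1, h2, h3, h4, h5⟩)
    obtain ⟨q, hq⟩ := h𝓤₂.exists
    exact absurd (le_squeezing ⟨hb0, (hf q hq).1, φ, ⟨hφd, hφi, hφm⟩, hφz, hφs⟩) (not_le.2 hb)

end Squeezing

end

end GenSqueezing

theorem mainTheorem8 (n : ℕ) (hn : 1 ≤ n)
    (Ω : Set (GenSqueezing.Cn n)) (hΩ : GenSqueezing.IsDomainIn Ω)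
    (hΩ_bdd : Bornology.IsBounded Ω) (hΩ_bal : Balanced ℂ Ω) (hΩ_conv : Convex ℝ Ω)
    (D : Set (GenSqueezing.Cn n)) (hD : GenSqueezing.IsDomainIn D)
    (hD_bdd : Bornology.IsBounded D)
    (Dseq : ℕ → Set (GenSqueezing.Cn n)) (hDseq : GenSqueezing.Exhausts Dseq D) :
    (∀ z ∈ D, Tendsto (fun l => GenSqueezing.squeezing Ω (Dseq l) z) atTop
      (𝓝 (GenSqueezing.squeezing Ω D z))) ∧
    ∀ K : Set (GenSqueezing.Cn n), IsCompact K → K ⊆ D →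
      TendstoUniformlyOn (fun l => GenSqueezing.squeezing Ω (Dseq l))
        (GenSqueezing.squeezing Ω D) atTop K := by
  have h0 : (0 : GenSqueezing.Cn n) ∈ Ω := hΩ_bal.zero_mem hΩ.2.nonempty
  have hS : ∀ K ⊆ D, IsCompact K → ∀ᶠ l in atTop, K ⊆ Dseq l := fun K hK hKc => by
    obtain ⟨N, hN⟩ := hDseq.2 K hKc hK
    exact (eventually_gt_atTop N).mono hN
  have hlim : ∀ z ∈ D, Tendsto (fun q : ℕ × GenSqueezing.Cn n =>
      GenSqueezing.squeezing Ω (Dseq q.1) q.2) (atTop ×ˢ 𝓝 z)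
      (𝓝 (GenSqueezing.squeezing Ω D z)) := fun z hz =>
    GenSqueezing.tendsto_squeezing hΩ.1 hΩ_bdd hΩ_conv hΩ_bal h0 hD.1 hD.2.isPreconnected hD_bdd
      (fun l => (hDseq.1 l).1.1) (fun l => (hDseq.1 l).2) hS hz
  -- The constant exhaustion yields continuity of the limit function, which turns joint convergence
  -- into locally uniform convergence.
  have hconst : ∀ z ∈ D, Tendsto (fun q : ℕ × GenSqueezing.Cn n =>
      GenSqueezing.squeezing Ω D q.2) (atTop ×ˢ 𝓝 z)
      (𝓝 (GenSqueezing.squeezing Ω D z)) := fun z hz =>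
    GenSqueezing.tendsto_squeezing (S := fun _ => D) hΩ.1 hΩ_bdd hΩ_conv hΩ_bal h0 hD.1
      hD.2.isPreconnected hD_bdd (fun _ => hD.1) (fun _ => Set.Subset.rfl)
      (fun K hK _ => Eventually.of_forall fun _ => hK) hz
  refine ⟨fun z hz => (hlim z hz).comp (tendsto_id.prodMk tendsto_const_nhds), ?_⟩
  intro K hK hKD
  rw [← tendstoLocallyUniformlyOn_iff_tendstoUniformlyOn_of_compact hK,
    tendstoLocallyUniformlyOn_iff_forall_tendsto]
  intro z hz
  have h := ((hconst z (hKD hz)).prodMk_nhds (hlim z (hKD hz))).mono_left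
    (Filter.prod_mono le_rfl (nhdsWithin_le_nhds (s := K)))
  exact h.mono_right (nhds_le_uniformity _)
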